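/- Let $(M^5,g_\eta,\eta,\xi,J)$ be a $5$-dimensional contact metric manifold: $\eta$ is a contact form with Reeb field $\xi$, $J$ is an almost complex structure on $H=\ker\eta$, extended by $J\xi=0$, and $g_\eta(X,Y)=d\eta(X,JY)+\eta(X)\eta(Y)$ is a Riemannian metric, where $d\eta(X,Y)=X\eta(Y)-Y\eta(X)-\eta([X,Y])$. Suppose that it is a strictly pseudoconvex CR manifold, i.e. $[JX,Y]+[X,JY]\in\Gamma(H)$ and $J([JX,Y]+[X,JY])-[JX,JY]+[X,Y]=0$ for all $X,Y\in\Gamma(H)$. Let $\nabla$ be the generalized Tanaka–Webster connection and $R$ its curvature. With $T(X,Y)=\nabla_XY-\nabla_YX-[X,Y]$, it is characterized by $\nabla\eta=0$, $\nabla\xi=0$, $\nabla g_\eta=0$, $T=d\eta\otimes\xi$ on $H$, $T(\xi,\cdot)=-\tfrac12 J\circ\mathcal L_\xi J$ and $g_\eta((\nabla_XJ)Y,Z)=\tfrac12 d\eta(X,N_H(Y,Z))$, where $N_H(Y,Z)=N(Y_H,Z_H)$ and $N(Y,Z)=J^2[Y,Z]+[JY,JZ]-J[Y,JZ]-J[JY,Z]+d\eta(Y,Z)\xi$.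 Let $$s=\sum_{a,b=1}^4 g_\eta\big(R(e_a,e_b)e_b,e_a\big)$$ be the Webster scalar curvature, normalized as the trace over $H$ of the Ricci tensor $\mathrm{Ric}(X,Y)=\sum_a g_\eta(R(e_a,X)Y,e_a)$ of $\nabla$, for an orthonormal basis $(e_a)$ of $H$. Suppose that $s$ is a negative constant. Equip $M$ with its canonical spin$^c$ structure, with spinor bundle $S=\Lambda_H^{0,0}\oplus\Lambda_H^{0,1}\oplus\Lambda_H^{0,2}$, determinant line bundle $L=\Lambda_H^{0,2}M$ and, for $\alpha\in\Lambda_H^{0,q}$, Clifford multiplication $$X\cdot\alpha=\sqrt2\big((X_H^{0,1})^*\wedge\alpha-X_H^{0,1}\lrcorner\alpha\big)+(-1)^{q+1}i\,\eta(X)\alpha .$$ For a unitary connection $A$ on $L$ let $\nabla^A$ be the connection on $S$ induced by $\nabla$ and $A$: in a local orthonormal frame $e=(e_1,e_2=Je_1,e_3,e_4=Je_3,e_5=\xi)$, with $S$ trivialized by $1,\bar\theta_1,\bar\theta_2,\bar\theta_1\wedge\bar\theta_2$, where $\bar\theta_1,\bar\theta_2$ are the $(0,1)$-forms dual to $(e_1+ie_2)/\sqrt2$,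 $(e_3+ie_4)/\sqrt2$, and with $A_e$ the connection form of $A$ with respect to $\bar\theta_1\wedge\bar\theta_2$, $$\nabla^A_X\psi=X(\psi)+\tfrac12\sum_{i<j}g_\eta(\nabla_Xe_i,e_j)\,e_i\cdot e_j\cdot\psi+\tfrac12A_e(X)\psi .$$ Let $D_A\psi=\sum_{i=1}^4e_i\cdot\nabla^A_{e_i}\psi+\xi\cdot\nabla^A_\xi\psi$, let $F_A$ be the curvature form of $A$ (locally $F_A=dA_e$), and let $$\sigma(\psi)(X,Y)=\langle X\cdot Y\cdot\psi,\psi\rangle+g_\eta(X,Y)|\psi|^2,$$ with $\langle\cdot,\cdot\rangle$ the natural Hermitian product on $S$, linear in the first argument. For a $2$-form $\beta$ with horizontal part $\beta_H$ let $\beta^+=\tfrac12(\beta_H+\star\beta_H)$ be the self-dual part, where $\star\beta=*(\eta\wedge\beta)$ and $M$ is oriented by $\eta\wedge(d\eta)^2$. Let $A$ be the connection on $L$ induced by $\nabla$, and let $\psi=\sqrt{-s}\,\psi_0$, where $\psi_0$ is the constant function $1$ in $\Lambda_H^{0,0}M$. Then $A$ is a unitary connection on $L$, and $(A,\psi)$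 solves the $5$-dimensional Seiberg–Witten like equations $$D_A\psi=0,\qquad F_A^+=-\tfrac14\,\sigma(\psi)^+ .$$ -/

import Mathlib

open Bundle FiberBundle VectorField
open scoped Manifold ContDiff

namespace ContactSW

noncomputable section

/-- The model space of a `5`-manifold. -/
abbrev E5 := EuclideanSpace ℝ (Fin 5)

variable {M : Type*} [TopologicalSpace M] [ChartedSpace E5 M]

/-- The directional derivative at `x`, along the tangent vector `u`, of a real or complex valued
function on `M`. -/
def dirDeriv {F : Type*} [NormedAddCommGroup F] [NormedSpace ℝ F] (f : M → F) (x : M)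
    (u : TangentSpace (𝓡 5) x) : F :=
  mvfderiv (𝓡 5) f x u

/-- A vector field is smooth. -/
def SmoothField (X : Π x : M, TangentSpace (𝓡 5) x) [IsManifold (𝓡 5) ∞ M] : Prop :=
  ContMDiff (𝓡 5) (𝓡 5).tangent ∞ fun x ↦ (⟨x, X x⟩ : TangentBundle (𝓡 5) M)

/-- A vector field is differentiable at a point. -/
def DiffFieldAt (X : Π x : M, TangentSpace (𝓡 5) x) (x : M) [IsManifold (𝓡 5) ∞ M] : Prop :=
  MDifferentiableAt (𝓡 5) (𝓡 5).tangent (fun y ↦ (⟨y, X y⟩ : TangentBundle (𝓡 5) M)) x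

variable [IsManifold (𝓡 5) ∞ M]

/-- A tangent vector at `x`, extended to a vector field that is smooth near `x`. -/
abbrev ext {x : M} (v : TangentSpace (𝓡 5) x) : Π y : M, TangentSpace (𝓡 5) y :=
  extend E5 v

/-- The exterior derivative of a one-form `θ` (real or complex valued, smooth near `x`):
`dθ(U, V) = U(θ(V)) - V(θ(U)) - θ([U, V])`, where `U`, `V` are any vector fields that extend
`u`, `v` smoothly. -/
def extD {F : Type*} [NormedAddCommGroup F] [NormedSpace ℝ F]
    (θ : Π x : M, TangentSpace (𝓡 5) x → F) (x : M) (u v : TangentSpace (𝓡 5) x) : F :=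
  dirDeriv (fun y ↦ θ y (ext v y)) x u - dirDeriv (fun y ↦ θ y (ext u y)) x v
    - θ x (mlieBracket (𝓡 5) (ext u) (ext v) x)

/-! ### Contact metric manifolds -/

variable (M) in
/-- A contact metric structure `(g, η, ξ, J)` on a `5`-manifold. -/
structure ContactMetric where
  /-- the contact form -/
  η : Π x : M, TangentSpace (𝓡 5) x →L[ℝ] ℝ
  /-- the Reeb vector field -/
  ξ : Π x : M, TangentSpace (𝓡 5) x
  /-- the almost complex structure of `H = ker η`, extended by `J ξ = 0` -/
  J : Π x : M, TangentSpace (𝓡 5) x →L[ℝ] TangentSpace (𝓡 5) x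
  /-- the Webster metric -/
  g : ContMDiffRiemannianMetric (𝓡 5) ∞ E5 (fun x : M ↦ TangentSpace (𝓡 5) x)
  smooth_η : ContMDiff (𝓡 5) ((𝓡 5).prod 𝓘(ℝ, E5 →L[ℝ] ℝ)) ∞
    fun x ↦ TotalSpace.mk' (E5 →L[ℝ] ℝ) (E := fun x : M ↦ TangentSpace (𝓡 5) x →L[ℝ] ℝ) x (η x)
  smooth_ξ : SmoothField ξ
  smooth_J : ContMDiff (𝓡 5) ((𝓡 5).prod 𝓘(ℝ, E5 →L[ℝ] E5)) ∞
    fun x ↦ TotalSpace.mk' (E5 →L[ℝ] E5)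
      (E := fun x : M ↦ TangentSpace (𝓡 5) x →L[ℝ] TangentSpace (𝓡 5) x) x (J x)
  η_ξ : ∀ x, η x (ξ x) = 1
  dη_ξ : ∀ x v, extD (fun y ↦ η y) x (ξ x) v = 0
  J_ξ : ∀ x, J x (ξ x) = 0
  η_J : ∀ x v, η x (J x v) = 0
  J_sq : ∀ x v, J x (J x v) = -v + η x v • ξ x
  /-- `g(u, v) = dη(u, J v) + η(u) η(v)`. As `g` is positive definite, `dη` is nondegenerate on
  `H`, so `η ∧ (dη)² ≠ 0` everywhere. -/
  g_eq : ∀ x u v, g.inner x u v = extD (fun y ↦ η y) x u (J x v) + η x u * η x v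

namespace ContactMetric

variable (C : ContactMetric M)

/-- The two-form `dη`. -/
def dη (x : M) (u v : TangentSpace (𝓡 5) x) : ℝ := extD (fun y ↦ C.η y) x u v

/-- The projection `Π : TM → H` along `ξ`. -/
def proj (x : M) (v : TangentSpace (𝓡 5) x) : TangentSpace (𝓡 5) x := v - C.η x v • C.ξ x

/-- The vector field `J X`. -/
def JF (X : Π x : M, TangentSpace (𝓡 5) x) : Π x : M, TangentSpace (𝓡 5) x := fun x ↦ C.J x (X x)

/-- The vector field `Π X`. -/
def projF (X : Π x : M, TangentSpace (𝓡 5) x) : Π x : M, TangentSpace (𝓡 5) x :=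
  fun x ↦ C.proj x (X x)

/-- Strict pseudoconvexity of the CR structure: `(H, J)` is a CR structure, i.e. for horizontal
vector fields `X`, `Y` the field `[JX, Y] + [X, JY]` is horizontal and
`J([JX, Y] + [X, JY]) - [JX, JY] + [X, Y] = 0`. (Positivity of the Levi form `dη(·, J ·)` on `H` is
part of the contact metric structure.) -/
def IsStrictlyPseudoconvexCR : Prop :=
  ∀ X Y : Π x : M, TangentSpace (𝓡 5) x, SmoothField X → SmoothField Y →
    (∀ x, C.η x (X x) = 0) → (∀ x, C.η x (Y x) = 0) → ∀ x,
    C.η x (mlieBracket (𝓡 5) (C.JF X) Y x + mlieBracket (𝓡 5) X (C.JF Y) x) = 0 ∧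
    C.J x (mlieBracket (𝓡 5) (C.JF X) Y x + mlieBracket (𝓡 5) X (C.JF Y) x)
      - mlieBracket (𝓡 5) (C.JF X) (C.JF Y) x + mlieBracket (𝓡 5) X Y x = 0

/-! ### The generalized Tanaka-Webster connection -/

/-- `(𝓛_ξ J) X = [ξ, JX] - J [ξ, X]`. -/
def lieξJ (X : Π x : M, TangentSpace (𝓡 5) x) (x : M) : TangentSpace (𝓡 5) x :=
  mlieBracket (𝓡 5) C.ξ (C.JF X) x - C.J x (mlieBracket (𝓡 5) C.ξ X x)

/-- `N(Y, Z) = J²[Y, Z] + [JY, JZ] - J[Y, JZ] - J[JY, Z] + dη(Y, Z) ξ`. -/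
def nijenhuis (Y Z : Π x : M, TangentSpace (𝓡 5) x) (x : M) : TangentSpace (𝓡 5) x :=
  C.J x (C.J x (mlieBracket (𝓡 5) Y Z x)) + mlieBracket (𝓡 5) (C.JF Y) (C.JF Z) x
    - C.J x (mlieBracket (𝓡 5) Y (C.JF Z) x) - C.J x (mlieBracket (𝓡 5) (C.JF Y) Z x)
    + C.dη x (Y x) (Z x) • C.ξ x

/-- The conditions that characterize the generalized Tanaka-Webster connection among the affine
connections. As everywhere in Mathlib, `∇ Y x u` is `(∇_u Y)(x)`, and the torsion is
`T(X, Y) = ∇_X Y - ∇_Y X - [X, Y]`. -/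
structure IsTanakaWebster (D : CovariantDerivative (𝓡 5) E5 (fun x : M ↦ TangentSpace (𝓡 5) x)) :
    Prop where
  smooth : CovariantDerivative.ContMDiffCovariantDerivative D ∞
  /-- `∇ η = 0` -/
  parallel_η : ∀ (x : M) (u : TangentSpace (𝓡 5) x) (Y : Π x : M, TangentSpace (𝓡 5) x),
    DiffFieldAt Y x → dirDeriv (fun y ↦ C.η y (Y y)) x u = C.η x (D Y x u)
  /-- `∇ ξ = 0` -/
  parallel_ξ : ∀ (x : M) (u : TangentSpace (𝓡 5) x), D C.ξ x u = 0
  /-- `∇ g = 0` -/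
  parallel_g : ∀ (x : M) (u : TangentSpace (𝓡 5) x) (Y Z : Π x : M, TangentSpace (𝓡 5) x),
    DiffFieldAt Y x → DiffFieldAt Z x →
    dirDeriv (fun y ↦ C.g.inner y (Y y) (Z y)) x u
      = C.g.inner x (D Y x u) (Z x) + C.g.inner x (Y x) (D Z x u)
  /-- `T = dη ⊗ ξ` on `H` -/
  torsion_H : ∀ (x : M) (u v : TangentSpace (𝓡 5) x), C.η x u = 0 → C.η x v = 0 →
    D.torsion x u v = C.dη x u v • C.ξ x
  /-- `T(ξ, ·) = - ½ J ∘ 𝓛_ξ J` -/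
  torsion_ξ : ∀ (x : M) (X : Π x : M, TangentSpace (𝓡 5) x), DiffFieldAt X x →
    D.torsion x (C.ξ x) (X x) = -((1 / 2 : ℝ) • C.J x (C.lieξJ X x))
  /-- `g((∇_u J) Y, Z) = ½ dη(u, N(ΠY, ΠZ))` -/
  deriv_J : ∀ (x : M) (u : TangentSpace (𝓡 5) x) (Y Z : Π x : M, TangentSpace (𝓡 5) x),
    DiffFieldAt Y x → DiffFieldAt Z x →
    C.g.inner x (D (C.JF Y) x u - C.J x (D Y x u)) (Z x)
      = (1 / 2) * C.dη x u (C.nijenhuis (C.projF Y) (C.projF Z) x)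

/-- The curvature `R(u, v) w = ∇_u ∇_v w - ∇_v ∇_u w - ∇_[u, v] w` of an affine connection; `u`, `v`,
`w` are extended to vector fields. -/
def curvature (D : CovariantDerivative (𝓡 5) E5 (fun x : M ↦ TangentSpace (𝓡 5) x)) (x : M)
    (u v w : TangentSpace (𝓡 5) x) : TangentSpace (𝓡 5) x :=
  D (fun y ↦ D (ext w) y (ext v y)) x u - D (fun y ↦ D (ext w) y (ext u y)) x v
    - D (ext w) x (mlieBracket (𝓡 5) (ext u) (ext v) x)

/-! ### Adapted frames and the Webster scalar curvature -/

/-- An adapted orthonormal basis `(e₁, e₂ = J e₁, e₃, e₄ = J e₃, ξ)` of `T_x M` (numbered from `0`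
here). -/
structure IsAdaptedBasis (x : M) (e : Fin 5 → TangentSpace (𝓡 5) x) : Prop where
  orthonormal : ∀ i j, C.g.inner x (e i) (e j) = if i = j then 1 else 0
  J_zero : e 1 = C.J x (e 0)
  J_two : e 3 = C.J x (e 2)
  ξ_four : e 4 = C.ξ x

/-- A smooth local frame that is adapted at every point of the open set `U`. -/
structure IsAdaptedFrame (U : Set M) (e : Fin 5 → Π x : M, TangentSpace (𝓡 5) x) : Prop where
  isOpen : IsOpen U
  smooth : ∀ i, ContMDiffOn (𝓡 5) (𝓡 5).tangent ∞
    (fun x ↦ (⟨x, e i x⟩ : TangentBundle (𝓡 5) M)) U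
  adapted : ∀ x ∈ U, C.IsAdaptedBasis x (fun i ↦ e i x)

/-- The Ricci tensor `Ric(v, w) = ∑ₐ g(R(eₐ, v) w, eₐ)` of the connection, the sum over an
orthonormal basis of `H`. -/
def ricci (D : CovariantDerivative (𝓡 5) E5 (fun x : M ↦ TangentSpace (𝓡 5) x)) (x : M)
    (e : Fin 5 → TangentSpace (𝓡 5) x) (v w : TangentSpace (𝓡 5) x) : ℝ :=
  ∑ a : Fin 4, C.g.inner x (curvature D x (e a.castSucc) v w) (e a.castSucc)

/-- The scalar curvature at `x`: the trace `∑_b Ric(e_b, e_b)` of the Ricci tensor, over an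
orthonormal basis of `H`. -/
def scalarCurvature (D : CovariantDerivative (𝓡 5) E5 (fun x : M ↦ TangentSpace (𝓡 5) x)) (x : M)
    (e : Fin 5 → TangentSpace (𝓡 5) x) : ℝ :=
  ∑ b : Fin 4, C.ricci D x e (e b.castSucc) (e b.castSucc)

/-- The Webster scalar curvature of `M` is the function `s`. (At each point the trace does not
depend on the basis.) -/
def HasScalarCurvature (D : CovariantDerivative (𝓡 5) E5 (fun x : M ↦ TangentSpace (𝓡 5) x))
    (s : M → ℝ) : Prop :=
  ∀ (x : M) (e : Fin 5 → TangentSpace (𝓡 5) x), C.IsAdaptedBasis x e →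
    C.scalarCurvature D x e = s x

/-! ### The spinor bundle `S = Λ^{0,0} ⊕ Λ^{0,1} ⊕ Λ^{0,2}` and Clifford multiplication

A complex valued form of `T_x M ⊗ ℂ` is given by its restriction to real vectors. It is of type
`(0, q)`, i.e. annihilated by `T^{1,0}` and by `ξ`, iff inserting `J v` in place of `v` multiplies
it by `-i`. -/

lemma extD_η_antisymm (x : M) (u v : TangentSpace (𝓡 5) x) :
    extD (fun y ↦ C.η y) x u v = -extD (fun y ↦ C.η y) x v u := by
  simp only [extD]
  rw [mlieBracket_swap_apply]
  simp only [map_neg]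
  ring

lemma g_J_left (x : M) (u v : TangentSpace (𝓡 5) x) :
    C.g.inner x (C.J x u) v = -C.g.inner x u (C.J x v) := by
  rw [C.g.symm x u, C.g_eq x (C.J x u) v, C.g_eq x (C.J x v) u, C.extD_η_antisymm]
  simp [C.η_J]

/-- `Λ_H^{0,1}` at `x`. -/
def Form01 (x : M) : Submodule ℂ (TangentSpace (𝓡 5) x →ₗ[ℝ] ℂ) where
  carrier := {α | ∀ v, α (C.J x v) = -Complex.I * α v}
  add_mem' := by
    intro a b ha hb v
    rw [LinearMap.add_apply, LinearMap.add_apply, ha v, hb v]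
    ring
  zero_mem' := by intro v; simp
  smul_mem' := by
    intro c a ha v
    rw [LinearMap.smul_apply, LinearMap.smul_apply, ha v, smul_eq_mul, smul_eq_mul]
    ring

/-- `Λ_H^{0,2}` at `x`. -/
def Form02 (x : M) :
    Submodule ℂ (TangentSpace (𝓡 5) x →ₗ[ℝ] TangentSpace (𝓡 5) x →ₗ[ℝ] ℂ) where
  carrier := {β | (∀ v w, β v w = -β w v) ∧ ∀ v w, β (C.J x v) w = -Complex.I * β v w}
  add_mem' := by
    rintro a b ⟨ha, ha'⟩ ⟨hb, hb'⟩
    refine ⟨fun v w ↦ ?_, fun v w ↦ ?_⟩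
    · simp only [LinearMap.add_apply]
      rw [ha v w, hb v w]
      ring
    · simp only [LinearMap.add_apply, ha', hb']
      ring
  zero_mem' := by constructor <;> intros <;> simp
  smul_mem' := by
    rintro c a ⟨ha, ha'⟩
    refine ⟨fun v w ↦ ?_, fun v w ↦ ?_⟩
    · simp only [LinearMap.smul_apply, smul_eq_mul]
      rw [ha v w]
      ring
    · simp only [LinearMap.smul_apply, smul_eq_mul, ha']
      ring

/-- The fibre of the spinor bundle at `x`. -/
abbrev Spinor (x : M) : Type := ℂ × C.Form01 x × C.Form02 x

/-- The `(0,1)`-form `(X^{0,1})^* = ⟨·, X^{0,1}⟩` dual to `X^{0,1} = ½ (X_H + i J X)` with respect to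
the Hermitian extension of `g`, i.e. `v ↦ ½ (g(X_H, v) - i g(J X, v))`. -/
def dual01 (x : M) (X : TangentSpace (𝓡 5) x) : C.Form01 x :=
  ⟨{  toFun := fun v ↦ (1 / 2 : ℂ) *
        ((C.g.inner x (C.proj x X) v : ℂ) - Complex.I * (C.g.inner x (C.J x X) v : ℂ))
      map_add' := by
        intro v w
        simp only [map_add, Complex.ofReal_add]
        ring
      map_smul' := by
        intro r v
        simp only [map_smul, smul_eq_mul, Complex.ofReal_mul, RingHom.id_apply, Complex.real_smul]
        ring }, by
    intro v
    have h1 : C.g.inner x (C.proj x X) (C.J x v) = -C.g.inner x (C.J x X) v := by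
      have h := C.g_J_left x (C.proj x X) v
      have h' : C.J x (C.proj x X) = C.J x X := by simp [proj, C.J_ξ]
      rw [h'] at h
      linarith
    have h2 : C.g.inner x (C.J x X) (C.J x v) = C.g.inner x (C.proj x X) v := by
      have h := C.g_J_left x (C.J x X) v
      have h' : C.J x (C.J x X) = -C.proj x X := by
        rw [C.J_sq, proj]
        abel
      rw [h', map_neg, neg_apply] at h
      linarith
    simp only [LinearMap.coe_mk, AddHom.coe_mk, h1, h2, Complex.ofReal_neg]
    linear_combination (-(1 / 2 : ℂ) * (C.g.inner x (C.J x X) v : ℂ)) * Complex.I_sq⟩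

/-- The wedge product of two `(0,1)`-forms. -/
def wedge (x : M) (θ α : C.Form01 x) : C.Form02 x :=
  ⟨LinearMap.mk₂ ℝ (fun v w ↦ θ.1 v * α.1 w - θ.1 w * α.1 v)
      (by intros; simp only [map_add]; ring)
      (by intros; simp only [map_smul, Complex.real_smul]; ring)
      (by intros; simp only [map_add]; ring)
      (by intros; simp only [map_smul, Complex.real_smul]; ring), by
    refine ⟨fun v w ↦ ?_, fun v w ↦ ?_⟩
    · simp only [LinearMap.mk₂_apply]
      ring
    · simp only [LinearMap.mk₂_apply]
      rw [θ.2 v, α.2 v]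
      ring⟩

/-- The contraction `X^{0,1} ⌟ β` of a `(0,2)`-form with `X^{0,1} = ½ (X_H + i J X)`. -/
def contract (x : M) (X : TangentSpace (𝓡 5) x) (β : C.Form02 x) : C.Form01 x :=
  ⟨(1 / 2 : ℂ) • (β.1 (C.proj x X) + Complex.I • β.1 (C.J x X)), by
    have h : ∀ v w, β.1 v (C.J x w) = -Complex.I * β.1 v w := by
      intro v w
      rw [β.2.1 v, β.2.2 w v, β.2.1 w v]
      ring
    intro v
    simp only [LinearMap.smul_apply, LinearMap.add_apply, smul_eq_mul, h]
    ring⟩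

/-- Clifford multiplication by a tangent vector: on `(0,q)`-forms,
`X · α = √2 ((X^{0,1})^* ∧ α - X^{0,1} ⌟ α) + (-1)^(q+1) i η(X) α`. -/
def clifford (x : M) (X : TangentSpace (𝓡 5) x) (ψ : C.Spinor x) : C.Spinor x :=
  (-(Real.sqrt 2 : ℂ) * ((1 / 2 : ℂ) * (ψ.2.1.1 (C.proj x X) + Complex.I * ψ.2.1.1 (C.J x X)))
      - Complex.I * (C.η x X : ℂ) * ψ.1,
    (Real.sqrt 2 : ℂ) • (ψ.1 • C.dual01 x X - C.contract x X ψ.2.2)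
      + (Complex.I * (C.η x X : ℂ)) • ψ.2.1,
    (Real.sqrt 2 : ℂ) • C.wedge x (C.dual01 x X) ψ.2.1 - (Complex.I * (C.η x X : ℂ)) • ψ.2.2)

/-- The value `α(Z̄)` of the complex linear extension of a function `α`, for the unit vector
`Z̄ = (v + i J v) / √2` of `T^{0,1}`. -/
def evalZ (x : M) (α : TangentSpace (𝓡 5) x → ℂ) (v : TangentSpace (𝓡 5) x) : ℂ :=
  (α v + Complex.I * α (C.J x v)) / (Real.sqrt 2 : ℂ)

/-- The value `β(Z̄, W̄)` of the complex bilinear extension of `β`, for `Z̄ = (v + i J v) / √2` and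
`W̄ = (w + i J w) / √2`. -/
def evalZZ (x : M) (β : TangentSpace (𝓡 5) x → TangentSpace (𝓡 5) x → ℂ)
    (v w : TangentSpace (𝓡 5) x) : ℂ :=
  C.evalZ x (fun v' ↦ C.evalZ x (fun w' ↦ β v' w') w) v

/-- The form `θ̄` of the coframe dual to the unit vectors `Z̄ = (v + i J v) / √2`. -/
def thetaBar (x : M) (v : TangentSpace (𝓡 5) x) : C.Form01 x := (Real.sqrt 2 : ℂ) • C.dual01 x v

/-- The Hermitian product of spinors, complex linear in the first argument; the forms
`1, θ̄₁, θ̄₂, θ̄₁ ∧ θ̄₂` of an adapted orthonormal basis `e` are orthonormal. -/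
def herm (x : M) (e : Fin 5 → TangentSpace (𝓡 5) x) (φ ψ : C.Spinor x) : ℂ :=
  φ.1 * star ψ.1
    + C.evalZ x (fun v ↦ φ.2.1.1 v) (e 0) * star (C.evalZ x (fun v ↦ ψ.2.1.1 v) (e 0))
    + C.evalZ x (fun v ↦ φ.2.1.1 v) (e 2) * star (C.evalZ x (fun v ↦ ψ.2.1.1 v) (e 2))
    + C.evalZZ x (fun v w ↦ φ.2.2.1 v w) (e 0) (e 2)
      * star (C.evalZZ x (fun v w ↦ ψ.2.2.1 v w) (e 0) (e 2))

/-- The spinor field `ψ₀`, the constant function `1` in `Λ_H^{0,0}`. -/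
def ψ₀ (x : M) : C.Spinor x := (1, 0, 0)

/-! ### Connections on the canonical line bundle `L = Λ_H^{0,2}` -/

/-- The type of covariant derivatives on `Λ_H^{0,2}`: `A β x u v w` is `(∇_u β)(v, w)` at `x`. -/
abbrev LineConn := (Π x : M, C.Form02 x) → Π x : M, TangentSpace (𝓡 5) x →
  TangentSpace (𝓡 5) x → TangentSpace (𝓡 5) x → ℂ

/-- The connection induced by an affine connection `∇` on `Λ_H^{0,2}`:
`(∇_u β)(V, W) = u(β(V, W)) - β(∇_u V, W) - β(V, ∇_u W)`. -/
def inducedConn (D : CovariantDerivative (𝓡 5) E5 (fun x : M ↦ TangentSpace (𝓡 5) x)) :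
    C.LineConn :=
  fun β x u v w ↦ dirDeriv (fun y ↦ (β y).1 (ext v y) (ext w y)) x u
    - (β x).1 (D (ext v) x u) w - (β x).1 v (D (ext w) x u)

/-- The unit section `τ = θ̄₁ ∧ θ̄₂` of `L` defined by a frame. -/
def unitSection (e : Fin 5 → Π x : M, TangentSpace (𝓡 5) x) : Π x : M, C.Form02 x :=
  fun x ↦ C.wedge x (C.thetaBar x (e 0 x)) (C.thetaBar x (e 2 x))

/-- The local connection form of `A` in the frame `e`, with `∇_u τ = A_e(u) τ`: the value
`A_e(u) = (∇_u τ)(Z̄₁, Z̄₂)`. -/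
def connForm (A : C.LineConn) (e : Fin 5 → Π x : M, TangentSpace (𝓡 5) x) (x : M)
    (u : TangentSpace (𝓡 5) x) : ℂ :=
  C.evalZZ x (A (C.unitSection e) x u) (e 0 x) (e 2 x)

/-- `A` is a unitary connection on `L`: locally `∇_u (f τ) = (u(f) + f A_e(u)) τ`, with an imaginary
valued one-form `A_e`. -/
def IsUnitaryConn (A : C.LineConn) : Prop :=
  ∀ (U : Set M) (e : Fin 5 → Π x : M, TangentSpace (𝓡 5) x), C.IsAdaptedFrame U e →
    ∀ x ∈ U, ∀ u : TangentSpace (𝓡 5) x, (C.connForm A e x u).re = 0 ∧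
      ∀ f : M → ℂ, MDifferentiableAt (𝓡 5) 𝓘(ℝ, ℂ) f x → ∀ v w : TangentSpace (𝓡 5) x,
        A (fun y ↦ f y • C.unitSection e y) x u v w
          = (dirDeriv f x u + f x * C.connForm A e x u) * (C.unitSection e x).1 v w

/-- The curvature form `F_A`, locally the exterior derivative of the connection form. -/
def curvForm (A : C.LineConn) (e : Fin 5 → Π x : M, TangentSpace (𝓡 5) x) (x : M)
    (u v : TangentSpace (𝓡 5) x) : ℂ :=
  extD (C.connForm A e) x u v

/-! ### The spinorial connection and the Dirac operator -/

/-- The derivative of a spinor field along `u`, componentwise in the local trivialization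
`1, θ̄₁, θ̄₂, θ̄₁ ∧ θ̄₂` of `S` given by the frame `e`. -/
def flatDeriv (e : Fin 5 → Π x : M, TangentSpace (𝓡 5) x) (ψ : Π x : M, C.Spinor x) (x : M)
    (u : TangentSpace (𝓡 5) x) : C.Spinor x :=
  (dirDeriv (fun y ↦ (ψ y).1) x u,
    dirDeriv (fun y ↦ C.evalZ y (fun v ↦ (ψ y).2.1.1 v) (e 0 y)) x u • C.thetaBar x (e 0 x)
      + dirDeriv (fun y ↦ C.evalZ y (fun v ↦ (ψ y).2.1.1 v) (e 2 y)) x u • C.thetaBar x (e 2 x),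
    dirDeriv (fun y ↦ C.evalZZ y (fun v w ↦ (ψ y).2.2.1 v w) (e 0 y) (e 2 y)) x u
      • C.unitSection e x)

/-- The spinorial connection `∇^A` induced by the affine connection `D` and the connection `A` on
the determinant line bundle, in a local adapted frame:
`∇^A_u ψ = u(ψ) + ½ ∑_{i<j} g(D_u e_i, e_j) e_i · e_j · ψ + ½ A_e(u) ψ`. -/
def spinDeriv (D : CovariantDerivative (𝓡 5) E5 (fun x : M ↦ TangentSpace (𝓡 5) x))
    (A : C.LineConn) (e : Fin 5 → Π x : M, TangentSpace (𝓡 5) x) (ψ : Π x : M, C.Spinor x) (x : M)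
    (u : TangentSpace (𝓡 5) x) : C.Spinor x :=
  C.flatDeriv e ψ x u
    + (1 / 2 : ℂ) • ∑ i : Fin 5, ∑ j ∈ Finset.Ioi i,
        (C.g.inner x (D (e i) x u) (e j x) : ℂ)
          • C.clifford x (e i x) (C.clifford x (e j x) (ψ x))
    + ((1 / 2 : ℂ) * C.connForm A e x u) • ψ x

/-- The Kohn-Dirac operator `D_H^A ψ = ∑_{i ≤ 4} e_i · ∇^A_{e_i} ψ`. -/
def kohnDirac (D : CovariantDerivative (𝓡 5) E5 (fun x : M ↦ TangentSpace (𝓡 5) x))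
    (A : C.LineConn) (e : Fin 5 → Π x : M, TangentSpace (𝓡 5) x) (ψ : Π x : M, C.Spinor x)
    (x : M) : C.Spinor x :=
  ∑ i : Fin 4, C.clifford x (e i.castSucc x) (C.spinDeriv D A e ψ x (e i.castSucc x))

/-- The Dirac operator `D_A ψ = D_H^A ψ + ξ · ∇^A_ξ ψ`. -/
def dirac (D : CovariantDerivative (𝓡 5) E5 (fun x : M ↦ TangentSpace (𝓡 5) x))
    (A : C.LineConn) (e : Fin 5 → Π x : M, TangentSpace (𝓡 5) x) (ψ : Π x : M, C.Spinor x)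
    (x : M) : C.Spinor x :=
  C.kohnDirac D A e ψ x + C.clifford x (C.ξ x) (C.spinDeriv D A e ψ x (C.ξ x))

/-! ### Self-duality of two-forms -/

/-- The Riemannian volume form, in the orientation of `η ∧ (dη)²`, for which the adapted bases
`(e₁, J e₁, e₃, J e₃, ξ)` are positive. -/
def vol (x : M) (e : Fin 5 → TangentSpace (𝓡 5) x) (v : Fin 5 → TangentSpace (𝓡 5) x) : ℝ :=
  Matrix.det (Matrix.of fun i j ↦ C.g.inner x (e i) (v j))

/-- The Hodge star of a three-form `θ`:
`(*θ)(u, v) = ∑_{i<j<k} θ(e_i, e_j, e_k) vol(e_i, e_j, e_k, u, v)`. -/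
def hodgeStar (x : M) (e : Fin 5 → TangentSpace (𝓡 5) x)
    (θ : TangentSpace (𝓡 5) x → TangentSpace (𝓡 5) x → TangentSpace (𝓡 5) x → ℂ)
    (u v : TangentSpace (𝓡 5) x) : ℂ :=
  ∑ i : Fin 5, ∑ j ∈ Finset.Ioi i, ∑ k ∈ Finset.Ioi j,
    θ (e i) (e j) (e k) * (C.vol x e ![e i, e j, e k, u, v] : ℂ)

/-- The operator `⋆ β = *(η ∧ β)` on two-forms. -/
def star2 (x : M) (e : Fin 5 → TangentSpace (𝓡 5) x)
    (β : TangentSpace (𝓡 5) x → TangentSpace (𝓡 5) x → ℂ) (u v : TangentSpace (𝓡 5) x) : ℂ :=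
  C.hodgeStar x e
    (fun a b c ↦ (C.η x a : ℂ) * β b c - (C.η x b : ℂ) * β a c + (C.η x c : ℂ) * β a b) u v

/-- The self-dual part of a two-form `β`: the projection `½ (β_H + ⋆ β_H)` of its horizontal part
`β_H = β ∘ Π` to the eigenspace of `⋆` for the eigenvalue `1`. -/
def selfDualPart (x : M) (e : Fin 5 → TangentSpace (𝓡 5) x)
    (β : TangentSpace (𝓡 5) x → TangentSpace (𝓡 5) x → ℂ) (u v : TangentSpace (𝓡 5) x) : ℂ :=
  (1 / 2) * (β (C.proj x u) (C.proj x v)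
    + C.star2 x e (fun a b ↦ β (C.proj x a) (C.proj x b)) u v)

/-! ### The Seiberg-Witten like equations -/

/-- The two-form `σ(ψ)(X, Y) = ⟨X · Y · ψ, ψ⟩ + ⟨X, Y⟩ |ψ|²`. -/
def sigma (x : M) (e : Fin 5 → TangentSpace (𝓡 5) x) (ψ : C.Spinor x)
    (X Y : TangentSpace (𝓡 5) x) : ℂ :=
  C.herm x e (C.clifford x X (C.clifford x Y ψ)) ψ
    + (C.g.inner x X Y : ℂ) * C.herm x e ψ ψ

/-- `(A, ψ)` is a solution of the Seiberg-Witten like equations: `A` is a unitary connection on the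
determinant line bundle, and `D_A ψ = 0` and `F_A⁺ = -¼ σ(ψ)⁺` everywhere, computed in any local
adapted frame. -/
structure IsSeibergWittenSolution
    (D : CovariantDerivative (𝓡 5) E5 (fun x : M ↦ TangentSpace (𝓡 5) x))
    (A : C.LineConn) (ψ : Π x : M, C.Spinor x) : Prop where
  unitary : C.IsUnitaryConn A
  dirac_eq : ∀ (U : Set M) (e : Fin 5 → Π x : M, TangentSpace (𝓡 5) x), C.IsAdaptedFrame U e →
    ∀ x ∈ U, C.dirac D A e ψ x = 0
  curvature_eq : ∀ (U : Set M) (e : Fin 5 → Π x : M, TangentSpace (𝓡 5) x),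
    C.IsAdaptedFrame U e → ∀ x ∈ U, ∀ u v : TangentSpace (𝓡 5) x,
      C.selfDualPart x (fun i ↦ e i x) (C.curvForm A e x) u v
        = -(1 / 4) * C.selfDualPart x (fun i ↦ e i x) (C.sigma x (fun i ↦ e i x) (ψ x)) u v

end ContactMetric
end
end ContactSW

/-!
On a CR manifold the Tanaka-Webster connection `∇` preserves `J` (`cov_JF`), because the Nijenhuis
tensor of horizontal fields vanishes. Hence the connection matrix `ω` of an adapted frame is
skew-Hermitian on `H`, and `∇` induces on `L = Λ_H^{0,2}` the unitary connection with the form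
`A_e = i (ω₁₂ + ω₃₄)` (`connForm_inducedConn`).

*The Dirac equation.* Clifford multiplication by `½ ∑_{i<j} ω_{ij} e_i e_j` maps a constant function
`c` to `-½ i (ω₁₂ + ω₃₄) c`: its part in `Λ_H^{0,2}` vanishes as `ω` is skew-Hermitian
(`sum_clifford_clifford_scalar`). The term `½ A_e c` cancels it, so constant functions are parallel
spinors (`spinDeriv_smul_ψ₀`), and in particular harmonic.

*The curvature equation.* As the quadratic terms of the structure equations cancel, `F_A = i ρ` with
the Ricci form `ρ(u, v) = g(R(u, v) e₁, e₂) + g(R(u, v) e₃, e₄)` (`curvForm_inducedConn`). The first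
Bianchi identity on `H` has as its right side the terms `dη(Y, Z) T(ξ, X)` (`bianchi`). Here
`T(ξ, ·)` is symmetric, since `dη` is parallel and invariant under the flow of `ξ`, while `T(ξ, ·)`
anticommutes with `J` (`torsion_ξ_symm`). As the curvature operators commute with `J`, this gives
`ρ(e₁, e₃) = ρ(e₂, e₄)`, `ρ(e₁, e₄) = -ρ(e₂, e₃)` and `ρ(e₁, e₂) + ρ(e₃, e₄) = -s / 2`
(`ricciForm_relations`). Consequently the self-dual part of `F_A` is
`-¼ i s (e₁ ∧ e₂ + e₃ ∧ e₄)` (`selfDualPart_eq`). On the other side,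
`σ(c ψ₀) = -i c² (e₁ ∧ e₂ + e₃ ∧ e₄)` on `H` (`sigma_smul_ψ₀`), and the equation holds for
`c² = -s`.
-/

open Filter Topology

namespace ContactSW

noncomputable section

variable {M : Type*} [TopologicalSpace M] [ChartedSpace E5 M]

/-! ### Directional derivatives -/

section DirDeriv

variable {F : Type*} [NormedAddCommGroup F] [NormedSpace ℝ F]

lemma dirDeriv_congr {f f' : M → F} {x : M} (h : f =ᶠ[𝓝 x] f') (u : TangentSpace (𝓡 5) x) :
    dirDeriv f x u = dirDeriv f' x u := by
  unfold dirDeriv mvfderiv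
  rw [ContinuousLinearMap.comp_apply, ContinuousLinearMap.comp_apply, h.mfderiv_eq, h.self_of_nhds]

lemma dirDeriv_const (c : F) (x : M) (u : TangentSpace (𝓡 5) x) :
    dirDeriv (fun _ : M ↦ c) x u = 0 := by
  simp [dirDeriv, mvfderiv_const]

lemma dirDeriv_add {f f' : M → F} {x : M} (hf : MDifferentiableAt (𝓡 5) 𝓘(ℝ, F) f x)
    (hf' : MDifferentiableAt (𝓡 5) 𝓘(ℝ, F) f' x) (u : TangentSpace (𝓡 5) x) :
    dirDeriv (fun y ↦ f y + f' y) x u = dirDeriv f x u + dirDeriv f' x u := by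
  simp [dirDeriv, mvfderiv_fun_add hf hf']

lemma dirDeriv_mul {A : Type*} [NormedCommRing A] [NormedAlgebra ℝ A] {f f' : M → A} {x : M}
    (hf : MDifferentiableAt (𝓡 5) 𝓘(ℝ, A) f x) (hf' : MDifferentiableAt (𝓡 5) 𝓘(ℝ, A) f' x)
    (u : TangentSpace (𝓡 5) x) :
    dirDeriv (fun y ↦ f y * f' y) x u = f x * dirDeriv f' x u + f' x * dirDeriv f x u := by
  have h := (hf.hasMFDerivAt.mul hf'.hasMFDerivAt).mfderiv
  have h2 : mfderiv (𝓡 5) 𝓘(ℝ, A) (fun y ↦ f y * f' y) x = _ := h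
  unfold dirDeriv mvfderiv
  rw [ContinuousLinearMap.comp_apply, h2]
  rfl

/-- Directional derivatives commute with continuous linear maps of the target. -/
lemma dirDeriv_clm {G : Type*} [NormedAddCommGroup G] [NormedSpace ℝ G] (L : F →L[ℝ] G)
    {f : M → F} {x : M} (hf : MDifferentiableAt (𝓡 5) 𝓘(ℝ, F) f x) (u : TangentSpace (𝓡 5) x) :
    dirDeriv (fun y ↦ L (f y)) x u = L (dirDeriv f x u) := by
  have h := mfderiv_comp x (L.differentiableAt.mdifferentiableAt :
    MDifferentiableAt 𝓘(ℝ, F) 𝓘(ℝ, G) L (f x)) hf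
  have h2 : mfderiv (𝓡 5) 𝓘(ℝ, G) (fun y ↦ L (f y)) x = _ := h
  unfold dirDeriv mvfderiv
  rw [ContinuousLinearMap.comp_apply, h2, mfderiv_eq_fderiv, L.fderiv]
  rfl

lemma mdifferentiableAt_ofReal {f : M → ℝ} {x : M} (hf : MDifferentiableAt (𝓡 5) 𝓘(ℝ, ℝ) f x) :
    MDifferentiableAt (𝓡 5) 𝓘(ℝ, ℂ) (fun y ↦ (f y : ℂ)) x :=
  (Complex.ofRealCLM.differentiableAt.mdifferentiableAt (x := _)).comp x hf

end DirDeriv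

variable [IsManifold (𝓡 5) ∞ M]

/-! ### Smooth vector fields -/

lemma SmoothField.diffAt {X : Π x : M, TangentSpace (𝓡 5) x} (hX : SmoothField X) (x : M) :
    DiffFieldAt X x :=
  (hX x).mdifferentiableAt (by simp)

lemma SmoothField.add {X Y : Π x : M, TangentSpace (𝓡 5) x} (hX : SmoothField X)
    (hY : SmoothField Y) : SmoothField (X + Y) :=
  ContMDiff.add_section hX hY

lemma SmoothField.sub {X Y : Π x : M, TangentSpace (𝓡 5) x} (hX : SmoothField X)
    (hY : SmoothField Y) : SmoothField (X - Y) :=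
  ContMDiff.sub_section hX hY

lemma SmoothField.smul {f : M → ℝ} {X : Π x : M, TangentSpace (𝓡 5) x}
    (hf : ContMDiff (𝓡 5) 𝓘(ℝ, ℝ) ∞ f) (hX : SmoothField X) : SmoothField (f • X) :=
  ContMDiff.smul_section hf hX

lemma SmoothField.mlieBracket {X Y : Π x : M, TangentSpace (𝓡 5) x} (hX : SmoothField X)
    (hY : SmoothField Y) : SmoothField (mlieBracket (𝓡 5) X Y) := by
  intro x
  have : IsManifold (𝓡 5) ((⊤ : ℕ∞) + 1 : ℕ∞ω) M := by
    simpa using (inferInstance : IsManifold (𝓡 5) ∞ M)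
  have : IsManifold (𝓡 5) (minSmoothness ℝ 2) M := by
    simp only [minSmoothness_of_isRCLikeNormedField]
    infer_instance
  exact ContMDiffAt.mlieBracket_vectorField (m := ⊤) (n := ⊤) (hX x) (hY x) (by simp)

/-- The vector field `∇_X Y`. -/
def covF (D : CovariantDerivative (𝓡 5) E5 (fun x : M ↦ TangentSpace (𝓡 5) x))
    (X Y : Π x : M, TangentSpace (𝓡 5) x) : Π x : M, TangentSpace (𝓡 5) x :=
  fun x ↦ D Y x (X x)

lemma SmoothField.covF {D : CovariantDerivative (𝓡 5) E5 (fun x : M ↦ TangentSpace (𝓡 5) x)}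
    (hD : CovariantDerivative.ContMDiffCovariantDerivative D ∞)
    {X Y : Π x : M, TangentSpace (𝓡 5) x} (hX : SmoothField X)
    (hY : SmoothField Y) : SmoothField (covF D X Y) := by
  have h := hD.contMDiff.contMDiff (σ := Y) (by simpa using! hY.contMDiffOn)
  rw [contMDiffOn_univ] at h
  exact ContMDiff.clm_bundle_apply h hX

lemma diffFieldAt_ext {x : M} (v : TangentSpace (𝓡 5) x) : DiffFieldAt (ext v) x :=
  mdifferentiableAt_extend (𝓡 5) E5 v

lemma ext_self {x : M} (v : TangentSpace (𝓡 5) x) : ext v x = v := by simp [ext]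

lemma DiffFieldAt.congr {X Y : Π x : M, TangentSpace (𝓡 5) x} {x : M} (hX : DiffFieldAt X x)
    (h : X =ᶠ[𝓝 x] Y) : DiffFieldAt Y x := by
  refine MDifferentiableAt.congr_of_eventuallyEq hX ?_
  filter_upwards [h] with y hy
  rw [hy]

section Cutoff

variable [T2Space M]

/-- Fields that are smooth on a neighbourhood of `x` agree near `x` with globally smooth fields. -/
lemma exists_smoothField_eventuallyEq {x : M} {U : Set M} (hU : U ∈ 𝓝 x)
    {X : Π x : M, TangentSpace (𝓡 5) x}
    (hX : ContMDiffOn (𝓡 5) (𝓡 5).tangent ∞ (fun x ↦ (⟨x, X x⟩ : TangentBundle (𝓡 5) M)) U) :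
    ∃ Y : Π x : M, TangentSpace (𝓡 5) x, SmoothField Y ∧ Y =ᶠ[𝓝 x] X := by
  obtain ⟨V, hVU, hV, hxV⟩ := mem_nhds_iff.1 hU
  obtain ⟨ρ, hρ⟩ := (SmoothBumpFunction.nhds_basis_support (I := 𝓡 5)
    (hV.mem_nhds hxV)).ex_mem
  refine ⟨(ρ : M → ℝ) • X, ContMDiffOn.smul_section_of_tsupport ρ.contMDiff.contMDiffOn hV hρ
    (hX.mono hVU), ?_⟩
  filter_upwards [ρ.eventuallyEq_one] with y hy
  change ρ y • X y = X y
  rw [hy]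
  exact one_smul ℝ (X y)

lemma exists_smoothField_ext {x : M} (v : TangentSpace (𝓡 5) x) :
    ∃ Y : Π x : M, TangentSpace (𝓡 5) x, SmoothField Y ∧ Y =ᶠ[𝓝 x] ext v := by
  obtain ⟨s, hs, h⟩ := exists_contMDiffOn_extend (k := ∞) (𝓡 5) E5 v
  exact exists_smoothField_eventuallyEq hs h

lemma exists_smoothField {x : M} (v : TangentSpace (𝓡 5) x) :
    ∃ Y : Π x : M, TangentSpace (𝓡 5) x, SmoothField Y ∧ Y x = v := by
  obtain ⟨Y, hY, h⟩ := exists_smoothField_ext v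
  exact ⟨Y, hY, by rw [h.self_of_nhds, ext_self]⟩

end Cutoff

/-! ### Local rules for connections and brackets -/

section Rules

variable (D : CovariantDerivative (𝓡 5) E5 (fun x : M ↦ TangentSpace (𝓡 5) x))

lemma cov_congr {X Y : Π x : M, TangentSpace (𝓡 5) x} {x : M} (hX : DiffFieldAt X x)
    (h : X =ᶠ[𝓝 x] Y) (u : TangentSpace (𝓡 5) x) : D X x u = D Y x u := by
  rw [D.isCovariantDerivativeOnUniv.congr_of_eventuallyEq hX (hX.congr h) univ_mem h]

lemma cov_add {X Y : Π x : M, TangentSpace (𝓡 5) x} {x : M} (hX : DiffFieldAt X x)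
    (hY : DiffFieldAt Y x) (u : TangentSpace (𝓡 5) x) : D (X + Y) x u = D X x u + D Y x u := by
  rw [D.isCovariantDerivativeOnUniv.add hX hY]
  rfl

lemma cov_smul {f : M → ℝ} {X : Π x : M, TangentSpace (𝓡 5) x} {x : M}
    (hf : MDifferentiableAt (𝓡 5) 𝓘(ℝ, ℝ) f x) (hX : DiffFieldAt X x)
    (u : TangentSpace (𝓡 5) x) :
    D (f • X) x u = f x • D X x u + dirDeriv f x u • X x := by
  rw [D.isCovariantDerivativeOnUniv.leibniz hX hf]
  rfl

lemma bracket_smul_right {f : M → ℝ} {X Y : Π x : M, TangentSpace (𝓡 5) x} {x : M}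
    (hf : MDifferentiableAt (𝓡 5) 𝓘(ℝ, ℝ) f x) (hY : DiffFieldAt Y x) :
    mlieBracket (𝓡 5) X (f • Y) x = dirDeriv f x (X x) • Y x + f x • mlieBracket (𝓡 5) X Y x :=
  mlieBracket_smul_right hf hY

lemma bracket_smul_left {f : M → ℝ} {X Y : Π x : M, TangentSpace (𝓡 5) x} {x : M}
    (hf : MDifferentiableAt (𝓡 5) 𝓘(ℝ, ℝ) f x) (hX : DiffFieldAt X x) :
    mlieBracket (𝓡 5) (f • X) Y x
      = -dirDeriv f x (Y x) • X x + f x • mlieBracket (𝓡 5) X Y x :=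
  mlieBracket_smul_left hf hX

lemma jacobi {X Y Z : Π x : M, TangentSpace (𝓡 5) x} (hX : SmoothField X) (hY : SmoothField Y)
    (hZ : SmoothField Z) (x : M) :
    mlieBracket (𝓡 5) X (mlieBracket (𝓡 5) Y Z) x
      = mlieBracket (𝓡 5) (mlieBracket (𝓡 5) X Y) Z x
        + mlieBracket (𝓡 5) Y (mlieBracket (𝓡 5) X Z) x := by
  have h2 : minSmoothness ℝ 2 ≤ (∞ : ℕ∞ω) := by
    simp only [minSmoothness_of_isRCLikeNormedField]
    exact WithTop.coe_le_coe.2 (le_top : (2 : ℕ∞) ≤ ⊤)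
  have : IsManifold (𝓡 5) (minSmoothness ℝ 3) M := by
    simp only [minSmoothness_of_isRCLikeNormedField]
    infer_instance
  exact leibniz_identity_mlieBracket_apply ((hX x).of_le h2) ((hY x).of_le h2) ((hZ x).of_le h2)

end Rules

/-! ### Smoothness of the structure tensors -/

namespace ContactMetric

variable (C : ContactMetric M)

lemma contMDiff_η {X : Π x : M, TangentSpace (𝓡 5) x} (hX : SmoothField X) :
    ContMDiff (𝓡 5) 𝓘(ℝ, ℝ) ∞ (fun y ↦ C.η y (X y)) := by
  intro x
  have h : ContMDiffAt (𝓡 5) ((𝓡 5).prod 𝓘(ℝ, ℝ)) ∞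
      (fun y ↦ TotalSpace.mk' ℝ (E := Bundle.Trivial M ℝ) y (C.η y (X y))) x :=
    ContMDiffAt.clm_bundle_apply (E₂ := Bundle.Trivial M ℝ) (C.smooth_η x) (hX x)
  simp only [contMDiffAt_totalSpace] at h
  exact h.2

lemma contMDiff_g {X Y : Π x : M, TangentSpace (𝓡 5) x} (hX : SmoothField X)
    (hY : SmoothField Y) :
    ContMDiff (𝓡 5) 𝓘(ℝ, ℝ) ∞ (fun y ↦ C.g.inner y (X y) (Y y)) := by
  intro x
  have h : ContMDiffAt (𝓡 5) ((𝓡 5).prod 𝓘(ℝ, ℝ)) ∞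
      (fun y ↦ TotalSpace.mk' ℝ (E := Bundle.Trivial M ℝ) y (C.g.inner y (X y) (Y y))) x :=
    ContMDiffAt.clm_bundle_apply₂ (F₁ := E5) (F₂ := E5) (E₃ := Bundle.Trivial M ℝ)
      (C.g.contMDiff x) (hX x) (hY x)
  simp only [contMDiffAt_totalSpace] at h
  exact h.2

lemma mdifferentiableAt_g {X Y : Π x : M, TangentSpace (𝓡 5) x} {x : M} (hX : DiffFieldAt X x)
    (hY : DiffFieldAt Y x) :
    MDifferentiableAt (𝓡 5) 𝓘(ℝ, ℝ) (fun y ↦ C.g.inner y (X y) (Y y)) x := by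
  have h : MDifferentiableAt (𝓡 5) ((𝓡 5).prod 𝓘(ℝ, ℝ))
      (fun y ↦ TotalSpace.mk' ℝ (E := Bundle.Trivial M ℝ) y (C.g.inner y (X y) (Y y))) x :=
    MDifferentiableWithinAt.clm_bundle_apply₂ (F₁ := E5) (F₂ := E5) (E₃ := Bundle.Trivial M ℝ)
      ((C.g.contMDiff x).mdifferentiableAt (by simp)) hX hY
  simp only [mdifferentiableAt_totalSpace] at h
  exact h.2

lemma smoothField_JF {X : Π x : M, TangentSpace (𝓡 5) x} (hX : SmoothField X) :
    SmoothField (C.JF X) :=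
  ContMDiff.clm_bundle_apply C.smooth_J hX

lemma smoothField_projF {X : Π x : M, TangentSpace (𝓡 5) x} (hX : SmoothField X) :
    SmoothField (C.projF X) :=
  hX.sub (.smul (C.contMDiff_η hX) C.smooth_ξ)

/-! ### Derivatives along smooth fields -/

/-- The derivative `X f` is smooth, as `(X f) ξ = [X, f ξ] - f [X, ξ]`. -/
lemma contMDiff_dirDeriv (C : ContactMetric M) {f : M → ℝ} (hf : ContMDiff (𝓡 5) 𝓘(ℝ, ℝ) ∞ f)
    {X : Π x : M, TangentSpace (𝓡 5) x} (hX : SmoothField X) :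
    ContMDiff (𝓡 5) 𝓘(ℝ, ℝ) ∞ (fun y ↦ dirDeriv f y (X y)) := by
  have h := (C.contMDiff_η (hX.mlieBracket (.smul hf C.smooth_ξ))).sub
    (hf.mul (C.contMDiff_η (hX.mlieBracket C.smooth_ξ)))
  refine h.congr fun y ↦ ?_
  rw [bracket_smul_right ((hf y).mdifferentiableAt (by simp)) (C.smooth_ξ.diffAt y)]
  simp [C.η_ξ]

/-- `[X, Y] f = X (Y f) - Y (X f)`, read off from the Jacobi identity for `X`, `Y`, `f ξ`. -/
lemma dirDeriv_mlieBracket (C : ContactMetric M) {f : M → ℝ} (hf : ContMDiff (𝓡 5) 𝓘(ℝ, ℝ) ∞ f)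
    {X Y : Π x : M, TangentSpace (𝓡 5) x} (hX : SmoothField X) (hY : SmoothField Y) (x : M) :
    dirDeriv f x (mlieBracket (𝓡 5) X Y x)
      = dirDeriv (fun y ↦ dirDeriv f y (Y y)) x (X x)
        - dirDeriv (fun y ↦ dirDeriv f y (X y)) x (Y x) := by
  have key : ∀ {X Y : Π x : M, TangentSpace (𝓡 5) x}, SmoothField X → SmoothField Y →
      mlieBracket (𝓡 5) X (mlieBracket (𝓡 5) Y (f • C.ξ)) x
        = dirDeriv (fun y ↦ dirDeriv f y (Y y)) x (X x) • C.ξ x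
          + dirDeriv f x (Y x) • mlieBracket (𝓡 5) X C.ξ x
          + dirDeriv f x (X x) • mlieBracket (𝓡 5) Y C.ξ x
          + f x • mlieBracket (𝓡 5) X (mlieBracket (𝓡 5) Y C.ξ) x := by
    intro X Y hX hY
    have e : mlieBracket (𝓡 5) Y (f • C.ξ)
        = (fun y ↦ dirDeriv f y (Y y)) • C.ξ + f • mlieBracket (𝓡 5) Y C.ξ := by
      funext y
      exact bracket_smul_right ((hf y).mdifferentiableAt (by simp)) (C.smooth_ξ.diffAt y)
    have hYf := C.contMDiff_dirDeriv hf hY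
    rw [e, mlieBracket_add_right ((SmoothField.smul hYf C.smooth_ξ).diffAt x)
      ((SmoothField.smul hf (hY.mlieBracket C.smooth_ξ)).diffAt x),
      bracket_smul_right ((hYf x).mdifferentiableAt (by simp)) (C.smooth_ξ.diffAt x),
      bracket_smul_right ((hf x).mdifferentiableAt (by simp))
        ((hY.mlieBracket C.smooth_ξ).diffAt x)]
    module
  have h1 := jacobi hX hY (SmoothField.smul hf C.smooth_ξ) x
  rw [key hX hY, key hY hX, bracket_smul_right ((hf x).mdifferentiableAt (by simp))
    (C.smooth_ξ.diffAt x), jacobi hX hY C.smooth_ξ x] at h1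
  have h2 := congrArg (C.η x) h1
  simp only [map_add, map_smul, C.η_ξ, smul_eq_mul] at h2
  linarith

/-! ### Pointwise algebra of a contact metric structure -/

lemma η_proj (x : M) (v : TangentSpace (𝓡 5) x) : C.η x (C.proj x v) = 0 := by
  simp [proj, C.η_ξ]

lemma eq_of_forall_g {x : M} {u v : TangentSpace (𝓡 5) x}
    (h : ∀ w, C.g.inner x u w = C.g.inner x v w) : u = v := by
  by_contra hne
  have h1 := C.g.pos x (u - v) (sub_ne_zero.2 hne)
  rw [C.g.symm, map_sub, C.g.symm, h, C.g.symm x (u - v) v, sub_self] at h1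
  exact h1.false

lemma g_ξ_right (x : M) (u : TangentSpace (𝓡 5) x) : C.g.inner x u (C.ξ x) = C.η x u := by
  rw [C.g.symm, C.g_eq, C.dη_ξ, C.η_ξ]
  ring

lemma g_ξ_left (x : M) (u : TangentSpace (𝓡 5) x) : C.g.inner x (C.ξ x) u = C.η x u := by
  rw [C.g.symm, C.g_ξ_right]

end ContactMetric

/-! ### The curvature of a connection on smooth fields -/

/-- The vector field `R(X, Y) Z`. -/
def riem (D : CovariantDerivative (𝓡 5) E5 (fun x : M ↦ TangentSpace (𝓡 5) x))
    (X Y Z : Π x : M, TangentSpace (𝓡 5) x) (x : M) : TangentSpace (𝓡 5) x :=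
  D (covF D Y Z) x (X x) - D (covF D X Z) x (Y x) - D Z x (mlieBracket (𝓡 5) X Y x)

section Riem

variable {D : CovariantDerivative (𝓡 5) E5 (fun x : M ↦ TangentSpace (𝓡 5) x)}

lemma riem_swap (X Y Z : Π x : M, TangentSpace (𝓡 5) x) (x : M) :
    riem D X Y Z x = -riem D Y X Z x := by
  simp only [riem]
  rw [mlieBracket_swap_apply, map_neg]
  abel

variable {X X' Y Z Z' : Π x : M, TangentSpace (𝓡 5) x} {f : M → ℝ}

/-- The curvature, defined with the fields `ext u` that are smooth only near `x`, is computed by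
globally smooth fields with the same germs at `x`. -/
lemma curvature_eq_riem (hD : CovariantDerivative.ContMDiffCovariantDerivative D ∞) {x : M}
    {u v w : TangentSpace (𝓡 5) x} (hX : SmoothField X) (hY : SmoothField Y) (hZ : SmoothField Z)
    (hXu : X =ᶠ[𝓝 x] ext u) (hYv : Y =ᶠ[𝓝 x] ext v) (hZw : Z =ᶠ[𝓝 x] ext w) :
    ContactMetric.curvature D x u v w = riem D X Y Z x := by
  have hcov : ∀ {Y : Π x : M, TangentSpace (𝓡 5) x} {v : TangentSpace (𝓡 5) x}, SmoothField Y →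
      Y =ᶠ[𝓝 x] ext v → covF D Y Z =ᶠ[𝓝 x] fun y ↦ D (ext w) y (ext v y) := by
    intro Y v hY hYv
    filter_upwards [eventually_eventually_nhds.2 hZw, hYv] with y hy hy'
    rw [covF, cov_congr D (hZ.diffAt y) hy, hy']
  have e1 : X x = u := by rw [hXu.self_of_nhds, ext_self]
  have e2 : Y x = v := by rw [hYv.self_of_nhds, ext_self]
  rw [ContactMetric.curvature, riem, ← cov_congr D ((hY.covF hD hZ).diffAt x) (hcov hY hYv),
    ← cov_congr D ((hX.covF hD hZ).diffAt x) (hcov hX hXu), ← cov_congr D (hZ.diffAt x) hZw,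
    ← hXu.mlieBracket_vectorField_eq hYv, e1, e2]

lemma riem_congr_left (hD : CovariantDerivative.ContMDiffCovariantDerivative D ∞) {x : M}
    (hX : SmoothField X) (hZ : SmoothField Z) (h : X =ᶠ[𝓝 x] X') :
    riem D X Y Z x = riem D X' Y Z x := by
  have h1 : covF D X Z =ᶠ[𝓝 x] covF D X' Z := by
    filter_upwards [h] with y hy
    rw [covF, covF, hy]
  rw [riem, riem, cov_congr D ((hX.covF hD hZ).diffAt x) h1,
    h.mlieBracket_vectorField_eq (EventuallyEq.refl _ Y), h.self_of_nhds]

lemma riem_congr_right (hD : CovariantDerivative.ContMDiffCovariantDerivative D ∞) {x : M}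
    (hX : SmoothField X) (hY : SmoothField Y) (hZ : SmoothField Z) (h : Z =ᶠ[𝓝 x] Z') :
    riem D X Y Z x = riem D X Y Z' x := by
  have h1 : ∀ X : Π x : M, TangentSpace (𝓡 5) x, covF D X Z =ᶠ[𝓝 x] covF D X Z' := by
    intro X
    filter_upwards [eventually_eventually_nhds.2 h] with y hy
    rw [covF, covF, cov_congr D (hZ.diffAt y) hy]
  rw [riem, riem, cov_congr D ((hX.covF hD hZ).diffAt x) (h1 X),
    cov_congr D ((hY.covF hD hZ).diffAt x) (h1 Y), cov_congr D (hZ.diffAt x) h]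

lemma riem_add_left (hD : CovariantDerivative.ContMDiffCovariantDerivative D ∞) {x : M}
    (hX : SmoothField X) (hX' : SmoothField X') (hZ : SmoothField Z) :
    riem D (X + X') Y Z x = riem D X Y Z x + riem D X' Y Z x := by
  have e : covF D (X + X') Z = covF D X Z + covF D X' Z := by
    funext y
    simp [covF]
  rw [riem, riem, riem, e, cov_add D ((hX.covF hD hZ).diffAt x) ((hX'.covF hD hZ).diffAt x),
    mlieBracket_add_left (hX.diffAt x) (hX'.diffAt x)]
  simp only [Pi.add_apply, map_add]
  abel

lemma riem_smul_left (hD : CovariantDerivative.ContMDiffCovariantDerivative D ∞) {x : M}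
    (hf : ContMDiff (𝓡 5) 𝓘(ℝ, ℝ) ∞ f) (hX : SmoothField X) (hZ : SmoothField Z) :
    riem D (f • X) Y Z x = f x • riem D X Y Z x := by
  have e : covF D (f • X) Z = f • covF D X Z := by
    funext y
    simp [covF]
  have hfx : MDifferentiableAt (𝓡 5) 𝓘(ℝ, ℝ) f x := (hf x).mdifferentiableAt (by simp)
  rw [riem, riem, e, cov_smul D hfx ((hX.covF hD hZ).diffAt x),
    bracket_smul_left hfx (hX.diffAt x)]
  simp only [Pi.smul_apply', map_add, map_smul, covF]
  module

lemma riem_add_right (hD : CovariantDerivative.ContMDiffCovariantDerivative D ∞) {x : M}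
    (hX : SmoothField X) (hY : SmoothField Y) (hZ : SmoothField Z) (hZ' : SmoothField Z') :
    riem D X Y (Z + Z') x = riem D X Y Z x + riem D X Y Z' x := by
  have e : ∀ X : Π x : M, TangentSpace (𝓡 5) x,
      covF D X (Z + Z') = covF D X Z + covF D X Z' := by
    intro X
    funext y
    exact cov_add D (hZ.diffAt y) (hZ'.diffAt y) _
  rw [riem, riem, riem, e, e, cov_add D ((hX.covF hD hZ).diffAt x) ((hX.covF hD hZ').diffAt x),
    cov_add D ((hY.covF hD hZ).diffAt x) ((hY.covF hD hZ').diffAt x),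
    cov_add D (hZ.diffAt x) (hZ'.diffAt x)]
  abel

lemma riem_smul_right (C : ContactMetric M)
    (hD : CovariantDerivative.ContMDiffCovariantDerivative D ∞) {x : M}
    (hf : ContMDiff (𝓡 5) 𝓘(ℝ, ℝ) ∞ f) (hX : SmoothField X) (hY : SmoothField Y)
    (hZ : SmoothField Z) :
    riem D X Y (f • Z) x = f x • riem D X Y Z x := by
  have hfx : ∀ y, MDifferentiableAt (𝓡 5) 𝓘(ℝ, ℝ) f y := fun y ↦
    (hf y).mdifferentiableAt (by simp)
  have e : ∀ X : Π x : M, TangentSpace (𝓡 5) x,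
      covF D X (f • Z) = f • covF D X Z + (fun y ↦ dirDeriv f y (X y)) • Z := by
    intro X
    funext y
    exact cov_smul D (hfx y) (hZ.diffAt y) _
  have key : ∀ {X Y : Π x : M, TangentSpace (𝓡 5) x}, SmoothField X → SmoothField Y →
      D (covF D Y (f • Z)) x (X x) = f x • D (covF D Y Z) x (X x)
        + dirDeriv f x (X x) • D Z x (Y x) + dirDeriv f x (Y x) • D Z x (X x)
        + dirDeriv (fun y ↦ dirDeriv f y (Y y)) x (X x) • Z x := by
    intro X Y hX hY
    have hYf := C.contMDiff_dirDeriv hf hY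
    rw [e, cov_add D ((SmoothField.smul hf (hY.covF hD hZ)).diffAt x)
      ((SmoothField.smul hYf hZ).diffAt x), cov_smul D (hfx x) ((hY.covF hD hZ).diffAt x),
      cov_smul D ((hYf x).mdifferentiableAt (by simp)) (hZ.diffAt x)]
    simp only [covF]
    module
  rw [riem, riem, key hX hY, key hY hX, cov_smul D (hfx x) (hZ.diffAt x),
    C.dirDeriv_mlieBracket hf hX hY]
  module

end Riem

namespace ContactMetric

variable {C : ContactMetric M}
  {D : CovariantDerivative (𝓡 5) E5 (fun x : M ↦ TangentSpace (𝓡 5) x)}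

/-! ### The torsion of the Tanaka-Webster connection -/

namespace IsTanakaWebster

lemma η_torsion (hD : C.IsTanakaWebster D) {X Y : Π x : M, TangentSpace (𝓡 5) x} {x : M}
    (hX : DiffFieldAt X x) (hY : DiffFieldAt Y x) :
    C.η x (D.torsion x (X x) (Y x)) = dirDeriv (fun y ↦ C.η y (Y y)) x (X x)
      - dirDeriv (fun y ↦ C.η y (X y)) x (Y x) - C.η x (mlieBracket (𝓡 5) X Y x) := by
  rw [D.torsion_apply hX hY, map_sub, map_sub, hD.parallel_η x _ Y hY, hD.parallel_η x _ X hX]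

/-- As `∇ η = 0`, the form `dη` is the `ξ`-component of the torsion; in particular it is a
tensor. -/
lemma dη_eq_η_torsion (hD : C.IsTanakaWebster D) (x : M) (u v : TangentSpace (𝓡 5) x) :
    C.dη x u v = C.η x (D.torsion x u v) := by
  have h := hD.η_torsion (diffFieldAt_ext u) (diffFieldAt_ext v)
  rw [ext_self, ext_self] at h
  rw [h]
  rfl

lemma dη_apply (hD : C.IsTanakaWebster D) {X Y : Π x : M, TangentSpace (𝓡 5) x} {x : M}
    (hX : DiffFieldAt X x) (hY : DiffFieldAt Y x) :
    C.dη x (X x) (Y x) = dirDeriv (fun y ↦ C.η y (Y y)) x (X x)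
      - dirDeriv (fun y ↦ C.η y (X y)) x (Y x) - C.η x (mlieBracket (𝓡 5) X Y x) := by
  rw [hD.dη_eq_η_torsion, hD.η_torsion hX hY]

/-- `dη(u, v) = g(J u, v)`. Applying `g_eq` to `J v` needs that `dη` is linear at `J (J v)`, which
is known through the torsion. -/
lemma dη_eq_g (hD : C.IsTanakaWebster D) (x : M) (u v : TangentSpace (𝓡 5) x) :
    C.dη x u v = C.g.inner x (C.J x u) v := by
  have h := C.g_eq x u (C.J x v)
  have h1 : C.dη x u (C.J x (C.J x v)) = -C.dη x u v := by
    have h2 : C.dη x u (C.ξ x) = 0 := by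
      rw [dη, C.extD_η_antisymm, C.dη_ξ, neg_zero]
    rw [hD.dη_eq_η_torsion] at h2
    rw [hD.dη_eq_η_torsion, hD.dη_eq_η_torsion, C.J_sq, map_add, map_add, map_neg, map_neg,
      map_smul, map_smul, h2, smul_zero, add_zero]
  rw [C.η_J, mul_zero, add_zero] at h
  rw [C.g_J_left, h]
  change _ = -C.dη x u (C.J x (C.J x v))
  rw [h1, neg_neg]

lemma dη_of_horizontal (hD : C.IsTanakaWebster D) {X Y : Π x : M, TangentSpace (𝓡 5) x}
    (hX : SmoothField X) (hY : SmoothField Y) (hXη : ∀ x, C.η x (X x) = 0)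
    (hYη : ∀ x, C.η x (Y x) = 0) (x : M) :
    C.dη x (X x) (Y x) = -C.η x (mlieBracket (𝓡 5) X Y x) := by
  rw [hD.dη_apply (hX.diffAt x) (hY.diffAt x), funext hXη, funext hYη, dirDeriv_const,
    dirDeriv_const]
  ring

lemma η_bracket_ξ (hD : C.IsTanakaWebster D) {X : Π x : M, TangentSpace (𝓡 5) x}
    (hX : SmoothField X) (x : M) :
    C.η x (mlieBracket (𝓡 5) C.ξ X x) = dirDeriv (fun y ↦ C.η y (X y)) x (C.ξ x) := by
  have h := hD.dη_apply (C.smooth_ξ.diffAt x) (hX.diffAt x)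
  rw [dη, C.dη_ξ, funext C.η_ξ, dirDeriv_const] at h
  linarith

lemma bracket_ξ (hD : C.IsTanakaWebster D) {X : Π x : M, TangentSpace (𝓡 5) x}
    (hX : SmoothField X) (x : M) :
    mlieBracket (𝓡 5) C.ξ X x = D X x (C.ξ x) - D.torsion x (C.ξ x) (X x) := by
  rw [D.torsion_apply (C.smooth_ξ.diffAt x) (hX.diffAt x), hD.parallel_ξ]
  abel

lemma η_torsion_ξ (hD : C.IsTanakaWebster D) (x : M) (v : TangentSpace (𝓡 5) x) :
    C.η x (D.torsion x (C.ξ x) v) = 0 := by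
  rw [← hD.dη_eq_η_torsion, dη, C.dη_ξ]

end IsTanakaWebster

lemma projF_horizontal (C : ContactMetric M) (X : Π x : M, TangentSpace (𝓡 5) x) (x : M) :
    C.η x (C.projF X x) = 0 :=
  C.η_proj x (X x)

/-- On horizontal fields `J² [X, Y] + dη(X, Y) ξ = -[X, Y]`, so that `N(X, Y) = 0` is the
integrability condition of the CR structure. -/
lemma nijenhuis_eq_zero (hD : C.IsTanakaWebster D) (hC : C.IsStrictlyPseudoconvexCR)
    {X Y : Π x : M, TangentSpace (𝓡 5) x} (hX : SmoothField X) (hY : SmoothField Y)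
    (hXη : ∀ x, C.η x (X x) = 0) (hYη : ∀ x, C.η x (Y x) = 0) (x : M) :
    C.nijenhuis X Y x = 0 := by
  have h := (hC X Y hX hY hXη hYη x).2
  rw [nijenhuis, C.J_sq, hD.dη_of_horizontal hX hY hXη hYη]
  rw [map_add] at h
  rw [← neg_eq_zero, ← h]
  module

section Pseudohermitian

variable [T2Space M]

/-- On a CR manifold the Tanaka-Webster connection preserves `J`. -/
lemma cov_JF (hD : C.IsTanakaWebster D) (hC : C.IsStrictlyPseudoconvexCR)
    {Y : Π x : M, TangentSpace (𝓡 5) x} (hY : SmoothField Y) (x : M) (u : TangentSpace (𝓡 5) x) :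
    D (C.JF Y) x u = C.J x (D Y x u) := by
  rw [← sub_eq_zero]
  refine C.eq_of_forall_g fun w ↦ ?_
  obtain ⟨Z, hZ, rfl⟩ := exists_smoothField w
  have hdη : C.dη x u 0 = 0 := by rw [hD.dη_eq_g, map_zero]
  rw [hD.deriv_J x u Y Z (hY.diffAt x) (hZ.diffAt x), nijenhuis_eq_zero hD hC
    (C.smoothField_projF hY) (C.smoothField_projF hZ) (C.projF_horizontal Y)
    (C.projF_horizontal Z), hdη]
  simp

/-- The torsion `T(ξ, ·)` anticommutes with `J`. -/
lemma torsion_ξ_J (hD : C.IsTanakaWebster D) (hC : C.IsStrictlyPseudoconvexCR) (x : M)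
    (v : TangentSpace (𝓡 5) x) :
    D.torsion x (C.ξ x) (C.J x v) = -C.J x (D.torsion x (C.ξ x) v) := by
  obtain ⟨X, hX, rfl⟩ := exists_smoothField v
  have h1 := hD.bracket_ξ hX x
  have h2 := hD.bracket_ξ (C.smoothField_JF hX) x
  have h3 := hD.torsion_ξ x X (hX.diffAt x)
  have h4 : C.η x (mlieBracket (𝓡 5) C.ξ (C.JF X) x) = 0 := by
    rw [hD.η_bracket_ξ (C.smoothField_JF hX)]
    simp [JF, C.η_J, dirDeriv_const]
  have h5 : C.η x (C.lieξJ X x) = 0 := by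
    rw [lieξJ, map_sub, h4, C.η_J, sub_zero]
  have h6 : C.J x (D.torsion x (C.ξ x) (X x)) = (1 / 2 : ℝ) • C.lieξJ X x := by
    rw [h3, map_neg, map_smul, C.J_sq, h5]
    module
  have h7 : C.lieξJ X x = C.J x (D.torsion x (C.ξ x) (X x))
      - D.torsion x (C.ξ x) (C.J x (X x)) := by
    rw [lieξJ, h1, h2, cov_JF hD hC hX, map_sub]
    simp only [JF]
    abel
  have h8 : D.torsion x (C.ξ x) (C.J x (X x))
      = C.J x (D.torsion x (C.ξ x) (X x)) - C.lieξJ X x := by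
    rw [h7]
    abel
  rw [h8, h6]
  module

/-- `dη` is invariant under the flow of `ξ` and parallel, so that `T(ξ, ·)` is skew for it. The
invariance is the Jacobi identity for `ξ` and two horizontal fields. -/
lemma dη_torsion_ξ (hD : C.IsTanakaWebster D) (hC : C.IsStrictlyPseudoconvexCR) (x : M)
    {u v : TangentSpace (𝓡 5) x} (hu : C.η x u = 0) (hv : C.η x v = 0) :
    C.g.inner x (C.J x (D.torsion x (C.ξ x) u)) v
      + C.g.inner x (C.J x u) (D.torsion x (C.ξ x) v) = 0 := by
  obtain ⟨X₀, hX₀, rfl⟩ := exists_smoothField u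
  obtain ⟨Y₀, hY₀, rfl⟩ := exists_smoothField v
  obtain ⟨X, hX, hXη, hXx⟩ : ∃ X, SmoothField X ∧ (∀ y, C.η y (X y) = 0) ∧ X x = X₀ x :=
    ⟨_, C.smoothField_projF hX₀, C.projF_horizontal X₀, by simp [projF, proj, hu]⟩
  obtain ⟨Y, hY, hYη, hYx⟩ : ∃ Y, SmoothField Y ∧ (∀ y, C.η y (Y y) = 0) ∧ Y x = Y₀ x :=
    ⟨_, C.smoothField_projF hY₀, C.projF_horizontal Y₀, by simp [projF, proj, hv]⟩
  rw [← hXx, ← hYx]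
  have hξ : ∀ {X : Π x : M, TangentSpace (𝓡 5) x}, SmoothField X → (∀ y, C.η y (X y) = 0) →
      ∀ y, C.η y (mlieBracket (𝓡 5) C.ξ X y) = 0 := by
    intro X hX hXη y
    rw [hD.η_bracket_ξ hX, funext hXη, dirDeriv_const]
  have h1 := hD.parallel_g x (C.ξ x) (C.JF X) Y ((C.smoothField_JF hX).diffAt x) (hY.diffAt x)
  have h2 : (fun y ↦ C.g.inner y (C.JF X y) (Y y))
      = fun y ↦ (-1) * C.η y (mlieBracket (𝓡 5) X Y y) := by
    funext y
    rw [JF, ← hD.dη_eq_g, hD.dη_of_horizontal hX hY hXη hYη]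
    ring
  have hXY := C.contMDiff_η (hX.mlieBracket hY)
  rw [h2, dirDeriv_mul mdifferentiableAt_const ((hXY x).mdifferentiableAt (by simp)),
    dirDeriv_const, ← hD.η_bracket_ξ (hX.mlieBracket hY), jacobi C.smooth_ξ hX hY, map_add,
    cov_JF hD hC hX] at h1
  have h3 := hD.dη_of_horizontal (C.smooth_ξ.mlieBracket hX) hY (hξ hX hXη) hYη x
  have h4 := hD.dη_of_horizontal hX (C.smooth_ξ.mlieBracket hY) hXη (hξ hY hYη) x
  rw [hD.dη_eq_g, hD.bracket_ξ hX, map_sub, map_sub, sub_apply] at h3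
  rw [hD.dη_eq_g, hD.bracket_ξ hY, map_sub] at h4
  simp only [JF] at h1
  linarith

/-- The pseudohermitian torsion is symmetric. -/
lemma torsion_ξ_symm (hD : C.IsTanakaWebster D) (hC : C.IsStrictlyPseudoconvexCR) (x : M)
    {u v : TangentSpace (𝓡 5) x} (hu : C.η x u = 0) (hv : C.η x v = 0) :
    C.g.inner x (D.torsion x (C.ξ x) u) v = C.g.inner x (D.torsion x (C.ξ x) v) u := by
  have h := dη_torsion_ξ hD hC x hu (C.η_J x v)
  have h1 : ∀ a b : TangentSpace (𝓡 5) x, C.η x b = 0 →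
      C.g.inner x (C.J x a) (C.J x b) = C.g.inner x a b := by
    intro a b hb
    rw [C.g_J_left, C.J_sq, hb, zero_smul, add_zero, map_neg, neg_neg]
  rw [torsion_ξ_J hD hC, map_neg, h1 _ _ hv, h1 _ _ (hD.η_torsion_ξ x v)] at h
  rw [C.g.symm x _ u]
  linarith

end Pseudohermitian

/-! ### Symmetries of the curvature -/

lemma g_riem_skew (hD : C.IsTanakaWebster D) {X Y Z W : Π x : M, TangentSpace (𝓡 5) x}
    (hX : SmoothField X) (hY : SmoothField Y) (hZ : SmoothField Z) (hW : SmoothField W) (x : M) :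
    C.g.inner x (riem D X Y Z x) (W x) = -C.g.inner x (riem D X Y W x) (Z x) := by
  have key : ∀ {X Y : Π x : M, TangentSpace (𝓡 5) x}, SmoothField X → SmoothField Y →
      dirDeriv (fun y ↦ dirDeriv (fun z ↦ C.g.inner z (Z z) (W z)) y (Y y)) x (X x)
        = C.g.inner x (D (covF D Y Z) x (X x)) (W x)
          + C.g.inner x (D Z x (Y x)) (D W x (X x))
          + (C.g.inner x (D Z x (X x)) (D W x (Y x))
            + C.g.inner x (Z x) (D (covF D Y W) x (X x))) := by
    intro X Y hX hY
    have h1 : (fun y ↦ dirDeriv (fun z ↦ C.g.inner z (Z z) (W z)) y (Y y))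
        = fun y ↦ C.g.inner y (covF D Y Z y) (W y) + C.g.inner y (Z y) (covF D Y W y) := by
      funext y
      exact hD.parallel_g y (Y y) Z W (hZ.diffAt y) (hW.diffAt y)
    have hYZ := hY.covF hD.smooth hZ
    have hYW := hY.covF hD.smooth hW
    rw [h1, dirDeriv_add (C.mdifferentiableAt_g (hYZ.diffAt x) (hW.diffAt x))
      (C.mdifferentiableAt_g (hZ.diffAt x) (hYW.diffAt x)),
      hD.parallel_g x (X x) _ W (hYZ.diffAt x) (hW.diffAt x),
      hD.parallel_g x (X x) Z _ (hZ.diffAt x) (hYW.diffAt x)]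
    rfl
  have h := C.dirDeriv_mlieBracket (C.contMDiff_g hZ hW) hX hY x
  rw [key hX hY, key hY hX, hD.parallel_g x _ Z W (hZ.diffAt x) (hW.diffAt x)] at h
  rw [C.g.symm x (riem D X Y W x)]
  simp only [riem, map_sub, sub_apply]
  linarith

/-- The first Bianchi identity on `H`. The torsion of horizontal fields `Y`, `Z` is a multiple of
the parallel field `ξ`, so only the terms `T(X, [Y, Z]) = dη(Y, Z) T(ξ, X)` are left. -/
lemma bianchi (hD : C.IsTanakaWebster D) {X Y Z : Π x : M, TangentSpace (𝓡 5) x}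
    (hX : SmoothField X) (hY : SmoothField Y) (hZ : SmoothField Z) {x : M}
    (hXη : ∀ᶠ y in 𝓝 x, C.η y (X y) = 0) (hYη : ∀ᶠ y in 𝓝 x, C.η y (Y y) = 0)
    (hZη : ∀ᶠ y in 𝓝 x, C.η y (Z y) = 0) {w : TangentSpace (𝓡 5) x} (hw : C.η x w = 0) :
    C.g.inner x (riem D X Y Z x) w + C.g.inner x (riem D Y Z X x) w
        + C.g.inner x (riem D Z X Y x) w
      = C.dη x (Y x) (Z x) * C.g.inner x (D.torsion x (C.ξ x) (X x)) w
        + C.dη x (Z x) (X x) * C.g.inner x (D.torsion x (C.ξ x) (Y x)) w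
        + C.dη x (X x) (Y x) * C.g.inner x (D.torsion x (C.ξ x) (Z x)) w := by
  have key : ∀ {X Y Z : Π x : M, TangentSpace (𝓡 5) x}, SmoothField X → SmoothField Y →
      SmoothField Z → (∀ᶠ y in 𝓝 x, C.η y (X y) = 0) → (∀ᶠ y in 𝓝 x, C.η y (Y y) = 0) →
      (∀ᶠ y in 𝓝 x, C.η y (Z y) = 0) →
      C.g.inner x (D (covF D Y Z) x (X x)) w - C.g.inner x (D (covF D Z Y) x (X x)) w
          - C.g.inner x (D X x (mlieBracket (𝓡 5) Y Z x)) w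
        = C.g.inner x (mlieBracket (𝓡 5) X (mlieBracket (𝓡 5) Y Z) x) w
          + C.dη x (Y x) (Z x) * C.g.inner x (D.torsion x (C.ξ x) (X x)) w := by
    intro X Y Z hX hY hZ hXη hYη hZη
    have hYZ := hY.covF hD.smooth hZ
    have hZY := hZ.covF hD.smooth hY
    have hB := hY.mlieBracket hZ
    -- `∇_Y Z = ∇_Z Y + [Y, Z] + dη(Y, Z) ξ` near `x`
    have h1 : covF D Y Z =ᶠ[𝓝 x] covF D Z Y
        + (mlieBracket (𝓡 5) Y Z + (fun y ↦ C.g.inner y (C.JF Y y) (Z y)) • C.ξ) := by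
      filter_upwards [hYη, hZη] with y hy hz
      have h := D.torsion_apply (hY.diffAt y) (hZ.diffAt y)
      rw [hD.torsion_H y _ _ hy hz, hD.dη_eq_g] at h
      simp only [covF, Pi.add_apply, Pi.smul_apply', JF, h]
      abel
    have hf := C.contMDiff_g (C.smoothField_JF hY) hZ
    have hfξ := SmoothField.smul hf C.smooth_ξ
    rw [cov_congr D (hYZ.diffAt x) h1, cov_add D (hZY.diffAt x) ((hB.add hfξ).diffAt x),
      cov_add D (hB.diffAt x) (hfξ.diffAt x),
      cov_smul D ((hf x).mdifferentiableAt (by simp)) (C.smooth_ξ.diffAt x), hD.parallel_ξ]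
    -- the torsion of `X` and `[Y, Z]`
    have h2 := D.torsion_apply (hX.diffAt x) (hB.diffAt x)
    have h3 : mlieBracket (𝓡 5) Y Z x
        = C.proj x (mlieBracket (𝓡 5) Y Z x) + C.η x (mlieBracket (𝓡 5) Y Z x) • C.ξ x := by
      simp [proj]
    have h4 : C.dη x (Y x) (Z x) = -C.η x (mlieBracket (𝓡 5) Y Z x) := by
      rw [hD.dη_apply (hY.diffAt x) (hZ.diffAt x), dirDeriv_congr (f' := fun _ ↦ (0 : ℝ)) hZη,
        dirDeriv_congr (f' := fun _ ↦ (0 : ℝ)) hYη, dirDeriv_const, dirDeriv_const]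
      ring
    have h5 : C.g.inner x (D.torsion x (X x) (mlieBracket (𝓡 5) Y Z x)) w
        = C.dη x (Y x) (Z x) * C.g.inner x (D.torsion x (C.ξ x) (X x)) w := by
      conv_lhs => rw [h3]
      rw [map_add, map_smul, hD.torsion_H x _ _ hXη.self_of_nhds
        (C.η_proj x _), D.torsion_antisymm (X x) (C.ξ x), h4]
      simp [C.g_ξ_left, hw]
    have h6 := congrArg (fun t ↦ C.g.inner x t w) h2
    simp only [map_sub, sub_apply] at h6
    simp only [map_add, map_smul, add_apply, smul_apply, smul_eq_mul, C.g_ξ_left, hw]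
    simp only [map_zero, zero_apply]
    linarith
  have k1 := key hX hY hZ hXη hYη hZη
  have k2 := key hY hZ hX hYη hZη hXη
  have k3 := key hZ hX hY hZη hXη hYη
  have hJ := congrArg (fun t ↦ C.g.inner x t w) (jacobi hX hY hZ x)
  have e1 : mlieBracket (𝓡 5) (mlieBracket (𝓡 5) X Y) Z x
      = -mlieBracket (𝓡 5) Z (mlieBracket (𝓡 5) X Y) x := mlieBracket_swap_apply
  have e2 : mlieBracket (𝓡 5) Y (mlieBracket (𝓡 5) X Z) x
      = -mlieBracket (𝓡 5) Y (mlieBracket (𝓡 5) Z X) x := by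
    have hn : mlieBracket (𝓡 5) X Z = (fun _ : M ↦ (-1 : ℝ)) • mlieBracket (𝓡 5) Z X := by
      rw [mlieBracket_swap]
      funext y
      simp
    rw [hn, bracket_smul_right mdifferentiableAt_const ((hZ.mlieBracket hX).diffAt x),
      dirDeriv_const]
    simp
  rw [e1, e2] at hJ
  simp only [map_add, map_neg, add_apply, neg_apply] at hJ
  simp only [riem, map_sub, sub_apply]
  linarith

lemma riem_JF [T2Space M] (hD : C.IsTanakaWebster D) (hC : C.IsStrictlyPseudoconvexCR)
    {X Y Z : Π x : M, TangentSpace (𝓡 5) x} (hX : SmoothField X) (hY : SmoothField Y)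
    (hZ : SmoothField Z) (x : M) : riem D X Y (C.JF Z) x = C.J x (riem D X Y Z x) := by
  have e : ∀ X : Π x : M, TangentSpace (𝓡 5) x, covF D X (C.JF Z) = C.JF (covF D X Z) := by
    intro X
    funext y
    exact cov_JF hD hC hZ y _
  rw [riem, riem, e, e, cov_JF hD hC (hY.covF hD.smooth hZ), cov_JF hD hC (hX.covF hD.smooth hZ),
    cov_JF hD hC hZ, map_sub, map_sub]

/-! ### Adapted frames -/

namespace IsAdaptedBasis

variable {x : M} {e : Fin 5 → TangentSpace (𝓡 5) x}

lemma η_eq (h : C.IsAdaptedBasis x e) (i : Fin 5) : C.η x (e i) = if i = 4 then 1 else 0 := by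
  rw [← C.g_ξ_right, ← h.ξ_four, h.orthonormal]

lemma J_one (h : C.IsAdaptedBasis x e) : C.J x (e 1) = -e 0 := by
  rw [h.J_zero, C.J_sq, h.η_eq]
  simp

lemma J_three (h : C.IsAdaptedBasis x e) : C.J x (e 3) = -e 2 := by
  rw [h.J_two, C.J_sq, h.η_eq]
  simp

/-- The expansion of a tangent vector in an adapted basis. -/
lemma sum_g_smul (h : C.IsAdaptedBasis x e) (v : TangentSpace (𝓡 5) x) :
    ∑ i, C.g.inner x v (e i) • e i = v := by
  have hg : ∀ (c : Fin 5 → ℝ) (j : Fin 5), C.g.inner x (∑ i, c i • e i) (e j) = c j := by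
    intro c j
    rw [map_sum, sum_apply]
    simp [h.orthonormal]
  have hli : LinearIndependent ℝ e := by
    rw [Fintype.linearIndependent_iff]
    intro c hc j
    rw [← hg c j, hc]
    simp
  have hfr : Fintype.card (Fin 5) = Module.finrank ℝ (TangentSpace (𝓡 5) x) := by
    change _ = Module.finrank ℝ E5
    simp
  have : FiniteDimensional ℝ (TangentSpace (𝓡 5) x) := inferInstanceAs (FiniteDimensional ℝ E5)
  have hspan := hli.span_eq_top_of_card_eq_finrank' hfr
  obtain ⟨c, rfl⟩ := (Submodule.mem_span_range_iff_exists_fun ℝ).1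
    (hspan ▸ Submodule.mem_top : v ∈ Submodule.span ℝ (Set.range e))
  simp only [hg]

end IsAdaptedBasis

/-- Globally defined smooth fields that form an adapted frame near the point `x`. -/
structure IsAdaptedNear (C : ContactMetric M) (x : M) (E : Fin 5 → Π x : M, TangentSpace (𝓡 5) x) :
    Prop where
  smooth : ∀ i, SmoothField (E i)
  adapted : ∀ᶠ y in 𝓝 x, C.IsAdaptedBasis y (fun i ↦ E i y)

lemma IsAdaptedFrame.exists_isAdaptedNear [T2Space M] {U : Set M}
    {e : Fin 5 → Π x : M, TangentSpace (𝓡 5) x} (he : C.IsAdaptedFrame U e) {x : M} (hx : x ∈ U) :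
    ∃ E, C.IsAdaptedNear x E ∧ ∀ i, E i =ᶠ[𝓝 x] e i := by
  choose E hE hEe using fun i ↦ exists_smoothField_eventuallyEq (he.isOpen.mem_nhds hx)
    (he.smooth i)
  refine ⟨E, ⟨hE, ?_⟩, hEe⟩
  filter_upwards [eventually_all.2 hEe, he.isOpen.mem_nhds hx] with y hy hyU
  simpa only [hy] using he.adapted y hyU

namespace IsAdaptedNear

variable {x : M} {E : Fin 5 → Π x : M, TangentSpace (𝓡 5) x}

/-- A map on smooth fields that is additive, local, and linear over smooth functions at `x` depends
only on the value at `x`. -/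
lemma tensorial (hE : C.IsAdaptedNear x E) {V : Type*} [AddCommGroup V] [Module ℝ V]
    (Φ : (Π x : M, TangentSpace (𝓡 5) x) → V)
    (hcongr : ∀ X X' : Π x : M, TangentSpace (𝓡 5) x, SmoothField X → X =ᶠ[𝓝 x] X' → Φ X = Φ X')
    (hadd : ∀ X X', SmoothField X → SmoothField X' → Φ (X + X') = Φ X + Φ X')
    (hsmul : ∀ (f : M → ℝ) X, ContMDiff (𝓡 5) 𝓘(ℝ, ℝ) ∞ f → SmoothField X →
      Φ (f • X) = f x • Φ X) {X : Π x : M, TangentSpace (𝓡 5) x} (hX : SmoothField X) :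
    Φ X = ∑ i, C.g.inner x (X x) (E i x) • Φ (E i) := by
  have hg := fun i ↦ C.contMDiff_g hX (hE.smooth i)
  have hs := fun i ↦ SmoothField.smul (hg i) (hE.smooth i)
  have h1 : X =ᶠ[𝓝 x] (fun y ↦ C.g.inner y (X y) (E 0 y)) • E 0
      + ((fun y ↦ C.g.inner y (X y) (E 1 y)) • E 1
      + ((fun y ↦ C.g.inner y (X y) (E 2 y)) • E 2
      + ((fun y ↦ C.g.inner y (X y) (E 3 y)) • E 3
      + (fun y ↦ C.g.inner y (X y) (E 4 y)) • E 4))) := by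
    filter_upwards [hE.adapted] with y hy
    conv_lhs => rw [← hy.sum_g_smul (X y)]
    rw [Fin.sum_univ_five]
    simp only [Pi.add_apply, Pi.smul_apply', add_assoc]
    rfl
  rw [hcongr _ _ hX h1,
    hadd _ _ (hs 0) ((hs 1).add ((hs 2).add ((hs 3).add (hs 4)))),
    hadd _ _ (hs 1) ((hs 2).add ((hs 3).add (hs 4))),
    hadd _ _ (hs 2) ((hs 3).add (hs 4)), hadd _ _ (hs 3) (hs 4),
    hsmul _ _ (hg 0) (hE.smooth 0), hsmul _ _ (hg 1) (hE.smooth 1),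
    hsmul _ _ (hg 2) (hE.smooth 2), hsmul _ _ (hg 3) (hE.smooth 3),
    hsmul _ _ (hg 4) (hE.smooth 4), Fin.sum_univ_five]
  simp only [add_assoc]

variable {X Y Z X' Y' Z' : Π x : M, TangentSpace (𝓡 5) x}

lemma riem_left (hE : C.IsAdaptedNear x E)
    (hD : CovariantDerivative.ContMDiffCovariantDerivative D ∞)
    (hX : SmoothField X) (hZ : SmoothField Z) :
    riem D X Y Z x = ∑ i, C.g.inner x (X x) (E i x) • riem D (E i) Y Z x :=
  hE.tensorial (fun X ↦ riem D X Y Z x) (fun _ _ hX h ↦ riem_congr_left hD hX hZ h)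
    (fun _ _ hX hX' ↦ riem_add_left hD hX hX' hZ)
    (fun _ _ hf hX ↦ riem_smul_left hD hf hX hZ) hX

lemma riem_middle (hE : C.IsAdaptedNear x E)
    (hD : CovariantDerivative.ContMDiffCovariantDerivative D ∞)
    (hY : SmoothField Y) (hZ : SmoothField Z) :
    riem D X Y Z x = ∑ i, C.g.inner x (Y x) (E i x) • riem D X (E i) Z x := by
  rw [riem_swap, hE.riem_left hD hY hZ, ← Finset.sum_neg_distrib]
  refine Finset.sum_congr rfl fun i _ ↦ ?_
  rw [riem_swap, smul_neg, neg_neg]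

lemma riem_right (hE : C.IsAdaptedNear x E)
    (hD : CovariantDerivative.ContMDiffCovariantDerivative D ∞)
    (hX : SmoothField X) (hY : SmoothField Y) (hZ : SmoothField Z) :
    riem D X Y Z x = ∑ i, C.g.inner x (Z x) (E i x) • riem D X Y (E i) x :=
  hE.tensorial (fun Z ↦ riem D X Y Z x) (fun _ _ hZ h ↦ riem_congr_right hD hX hY hZ h)
    (fun _ _ hZ hZ' ↦ riem_add_right hD hX hY hZ hZ')
    (fun _ _ hf hZ ↦ riem_smul_right C hD hf hX hY hZ) hZ

lemma riem_eq (hE : C.IsAdaptedNear x E)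
    (hD : CovariantDerivative.ContMDiffCovariantDerivative D ∞) (hX : SmoothField X)
    (hY : SmoothField Y) (hZ : SmoothField Z) (hX' : SmoothField X') (hY' : SmoothField Y')
    (hZ' : SmoothField Z') (hXx : X x = X' x) (hYx : Y x = Y' x) (hZx : Z x = Z' x) :
    riem D X Y Z x = riem D X' Y' Z' x := by
  rw [hE.riem_left hD hX hZ, hXx, ← hE.riem_left hD hX' hZ, hE.riem_middle hD hY hZ, hYx,
    ← hE.riem_middle hD hY' hZ, hE.riem_right hD hX' hY' hZ, hZx,
    ← hE.riem_right hD hX' hY' hZ']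

lemma curvature_apply [T2Space M] (hE : C.IsAdaptedNear x E)
    (hD : CovariantDerivative.ContMDiffCovariantDerivative D ∞) (hX : SmoothField X)
    (hY : SmoothField Y) (hZ : SmoothField Z) :
    curvature D x (X x) (Y x) (Z x) = riem D X Y Z x := by
  obtain ⟨X', hX', hX'x⟩ := exists_smoothField_ext (X x)
  obtain ⟨Y', hY', hY'x⟩ := exists_smoothField_ext (Y x)
  obtain ⟨Z', hZ', hZ'x⟩ := exists_smoothField_ext (Z x)
  rw [curvature_eq_riem hD hX' hY' hZ' hX'x hY'x hZ'x]
  refine hE.riem_eq hD hX' hY' hZ' hX hY hZ ?_ ?_ ?_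
  · rw [hX'x.self_of_nhds, ext_self]
  · rw [hY'x.self_of_nhds, ext_self]
  · rw [hZ'x.self_of_nhds, ext_self]

end IsAdaptedNear

/-! ### The Ricci form -/

/-- The matrix of `dη` on `H` in an adapted basis. -/
def stdForm : Fin 4 → Fin 4 → ℝ := ![![0, 1, 0, 0], ![-1, 0, 0, 0], ![0, 0, 0, 1], ![0, 0, -1, 0]]

/-- The algebra of the curvature of a Tanaka-Webster connection of CR type, in an adapted basis: `T`
is the pseudohermitian torsion, and `R a b 0 1 + R a b 2 3` are the coefficients of the Ricci form.
The first Bianchi identity makes the Ricci form `J`-invariant and relates its trace to the scalar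
curvature; the torsion drops out as `T` is symmetric. -/
lemma ricciForm_algebra {R : Fin 4 → Fin 4 → Fin 4 → Fin 4 → ℝ} {T : Fin 4 → Fin 4 → ℝ}
    (hleft : ∀ a b c d, R a b c d = -R b a c d) (hright : ∀ a b c d, R a b c d = -R a b d c)
    (h02 : ∀ a b, R a b 1 3 = R a b 0 2) (h03 : ∀ a b, R a b 1 2 = -R a b 0 3)
    (hB : ∀ a b c d, R a b c d + R b c a d + R c a b d
      = stdForm b c * T a d + stdForm c a * T b d + stdForm a b * T c d)
    (hT : ∀ a b, T a b = T b a) :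
    (R 0 1 0 1 + R 0 1 2 3) + (R 2 3 0 1 + R 2 3 2 3) = -(1 / 2) * ∑ b, ∑ a, R a b b a ∧
    R 0 2 0 1 + R 0 2 2 3 = R 1 3 0 1 + R 1 3 2 3 ∧
    R 0 3 0 1 + R 0 3 2 3 = -(R 1 2 0 1 + R 1 2 2 3) := by
  have hdiag : ∀ a c d, R a a c d = 0 := fun a c d ↦ by linarith [hleft a a c d]
  have hdiag' : ∀ a b c, R a b c c = 0 := fun a b c ↦ by linarith [hright a b c c]
  refine ⟨?_, ?_, ?_⟩
  · have b1 := hB 0 1 2 3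
    have b2 := hB 2 3 0 1
    have b3 := hB 0 1 3 2
    have b4 := hB 2 3 1 0
    simp [stdForm] at b1 b2 b3 b4
    simp only [Fin.sum_univ_four, hdiag]
    linarith [hT 0 1, hT 2 3, h02 2 0, h02 0 2, h02 1 3, h02 3 1, h03 1 2, h03 2 1, h03 0 3,
      h03 3 0, hleft 2 0 1 3, hright 3 0 2 1, hleft 3 0 0 3, hright 0 2 3 1, hright 0 1 3 2,
      hright 3 0 1 2, hright 0 1 1 0, hright 2 3 3 2, hleft 1 0 0 1, hright 3 1 2 0,
      hright 1 2 3 0, hleft 3 1 1 3, hright 2 3 1 0, hleft 3 2 2 3, hleft 2 0 0 2, hright 0 2 2 0,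
      hright 0 3 3 0, hright 1 2 2 1, hleft 2 1 1 2, hright 1 3 3 1, hleft 3 1 1 3]
  · have b1 := hB 0 2 1 0
    have b2 := hB 1 3 0 1
    have b3 := hB 0 2 3 2
    have b4 := hB 1 3 2 3
    simp [stdForm, hdiag'] at b1 b2 b3 b4
    linarith [hT 0 2, hT 1 3, hright 0 2 1 0, hleft 1 0 2 0, hright 0 1 2 0, hleft 0 1 1 3,
      hright 0 1 1 3, hright 0 1 3 1, h02 0 1, hright 0 2 3 2, hright 2 3 0 2, hleft 3 2 1 3,
      hright 1 3 2 3, h02 2 3]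
  · have b1 := hB 0 3 1 0
    have b2 := hB 1 2 0 1
    have b3 := hB 0 3 2 3
    have b4 := hB 1 2 3 2
    simp [stdForm, hdiag'] at b1 b2 b3 b4
    linarith [hT 0 3, hT 1 2, hright 0 3 1 0, hleft 1 0 3 0, hright 0 1 3 0, hright 0 1 1 2,
      hright 0 1 2 1, h03 0 1, h03 2 3, hleft 3 2 0 3, hright 1 2 3 2, hright 2 3 1 2]

variable {x : M} {E : Fin 5 → Π x : M, TangentSpace (𝓡 5) x}

/-- The coefficients `ρ(e_a, e_b)` of the Ricci form
`ρ(u, v) = g(R(u, v) e₁, e₂) + g(R(u, v) e₃, e₄)` in a frame. -/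
def ricciForm (C : ContactMetric M)
    (D : CovariantDerivative (𝓡 5) E5 (fun x : M ↦ TangentSpace (𝓡 5) x))
    (E : Fin 5 → Π x : M, TangentSpace (𝓡 5) x) (x : M)
    (X Y : Π x : M, TangentSpace (𝓡 5) x) : ℝ :=
  C.g.inner x (riem D X Y (E 0) x) (E 1 x) + C.g.inner x (riem D X Y (E 2) x) (E 3 x)

lemma ricciForm_swap (X Y : Π x : M, TangentSpace (𝓡 5) x) :
    C.ricciForm D E x X Y = -C.ricciForm D E x Y X := by
  simp only [ricciForm]
  rw [riem_swap X, riem_swap X, map_neg, map_neg, neg_apply, neg_apply]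
  ring

namespace IsAdaptedNear

lemma basis (hE : C.IsAdaptedNear x E) : C.IsAdaptedBasis x (fun i ↦ E i x) :=
  hE.adapted.self_of_nhds

lemma η_eventually (hE : C.IsAdaptedNear x E) (a : Fin 4) :
    ∀ᶠ y in 𝓝 x, C.η y (E a.castSucc y) = 0 := by
  filter_upwards [hE.adapted] with y hy
  rw [hy.η_eq]
  simp [Fin.ext_iff, a.isLt.ne]

lemma dη_eq (hE : C.IsAdaptedNear x E) (hD : C.IsTanakaWebster D) (a b : Fin 4) :
    C.dη x (E a.castSucc x) (E b.castSucc x) = stdForm a b := by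
  have h := hE.basis
  have ho := h.orthonormal
  have h0 := h.J_zero
  have h2 := h.J_two
  have h1 := h.J_one
  have h3 := h.J_three
  rw [hD.dη_eq_g]
  fin_cases a <;> fin_cases b <;>
    simp [stdForm, ← h0, ← h2, h1, h3, ho]

/-- The Ricci form is `J`-invariant on `H`, and its trace is determined by the scalar curvature. -/
lemma ricciForm_relations [T2Space M] (hE : C.IsAdaptedNear x E) (hD : C.IsTanakaWebster D)
    (hC : C.IsStrictlyPseudoconvexCR) {s : M → ℝ} (hs : C.HasScalarCurvature D s) :
    C.ricciForm D E x (E 0) (E 1) + C.ricciForm D E x (E 2) (E 3) = -(1 / 2) * s x ∧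
    C.ricciForm D E x (E 0) (E 2) = C.ricciForm D E x (E 1) (E 3) ∧
    C.ricciForm D E x (E 0) (E 3) = -C.ricciForm D E x (E 1) (E 2) := by
  have hb := hE.basis
  have hη : ∀ a : Fin 4, C.η x (E a.castSucc x) = 0 := fun a ↦ (hE.η_eventually a).self_of_nhds
  have hsm : ∀ a : Fin 4, SmoothField (E a.castSucc) := fun a ↦ hE.smooth _
  have hJ : ∀ a b : Fin 4, riem D (E a.castSucc) (E b.castSucc) (E 1) x
      = C.J x (riem D (E a.castSucc) (E b.castSucc) (E 0) x) := by
    intro a b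
    rw [← riem_JF hD hC (hsm a) (hsm b) (hE.smooth 0)]
    refine riem_congr_right hD.smooth (hsm a) (hsm b) (hE.smooth 1) ?_
    filter_upwards [hE.adapted] with y hy
    exact hy.J_zero
  have key := ricciForm_algebra
    (R := fun a b c d ↦ C.g.inner x (riem D (E a.castSucc) (E b.castSucc) (E c.castSucc) x)
      (E d.castSucc x))
    (T := fun a b ↦ C.g.inner x (D.torsion x (C.ξ x) (E a.castSucc x)) (E b.castSucc x))
    (fun a b c d ↦ by
      rw [riem_swap, map_neg, neg_apply])
    (fun a b c d ↦ g_riem_skew hD (hsm a) (hsm b) (hsm c) (hsm d) x)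
    (fun a b ↦ by
      change C.g.inner x (riem D (E a.castSucc) (E b.castSucc) (E 1) x) (E 3 x)
        = C.g.inner x (riem D (E a.castSucc) (E b.castSucc) (E 0) x) (E 2 x)
      rw [hJ, C.g_J_left, hb.J_three, map_neg, neg_neg])
    (fun a b ↦ by
      change C.g.inner x (riem D (E a.castSucc) (E b.castSucc) (E 1) x) (E 2 x)
        = -C.g.inner x (riem D (E a.castSucc) (E b.castSucc) (E 0) x) (E 3 x)
      rw [hJ, C.g_J_left, hb.J_two])
    (fun a b c d ↦ by
      have h := bianchi hD (hsm a) (hsm b) (hsm c) (hE.η_eventually a) (hE.η_eventually b)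
        (hE.η_eventually c) (hη d)
      rw [hE.dη_eq hD, hE.dη_eq hD, hE.dη_eq hD] at h
      exact h)
    (fun a b ↦ torsion_ξ_symm hD hC x (hη a) (hη b))
  have hscal := hs x _ hb
  simp only [scalarCurvature, ricci] at hscal
  simp only [hE.curvature_apply hD.smooth (hsm _) (hsm _) (hsm _)] at hscal
  rw [hscal] at key
  exact key

end IsAdaptedNear

/-! ### The connection matrix of an adapted frame -/

/-- The entry `ω_{ij}(u) = g(∇_u e_i, e_j)` of the connection matrix. -/
def connMatrix (C : ContactMetric M)
    (D : CovariantDerivative (𝓡 5) E5 (fun x : M ↦ TangentSpace (𝓡 5) x))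
    (e : Fin 5 → Π x : M, TangentSpace (𝓡 5) x) (x : M) (u : TangentSpace (𝓡 5) x)
    (i j : Fin 5) : ℝ :=
  C.g.inner x (D (e i) x u) (e j x)

namespace IsAdaptedFrame

variable {U : Set M} {e : Fin 5 → Π x : M, TangentSpace (𝓡 5) x} {x : M}

lemma diffAt (he : C.IsAdaptedFrame U e) (hx : x ∈ U) (i : Fin 5) : DiffFieldAt (e i) x :=
  ((he.smooth i).contMDiffAt (he.isOpen.mem_nhds hx)).mdifferentiableAt (by simp)

lemma connMatrix_skew (he : C.IsAdaptedFrame U e) (hx : x ∈ U) (hD : C.IsTanakaWebster D)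
    (u : TangentSpace (𝓡 5) x) (i j : Fin 5) :
    C.connMatrix D e x u i j = -C.connMatrix D e x u j i := by
  have h := hD.parallel_g x u _ _ (he.diffAt hx i) (he.diffAt hx j)
  have h1 : (fun y ↦ C.g.inner y (e i y) (e j y)) =ᶠ[𝓝 x] fun _ ↦ if i = j then (1 : ℝ) else 0 := by
    filter_upwards [he.isOpen.mem_nhds hx] with y hy
    exact (he.adapted y hy).orthonormal i j
  rw [dirDeriv_congr h1, dirDeriv_const, C.g.symm x (e i x)] at h
  simp only [connMatrix]
  linarith

lemma connMatrix_self (he : C.IsAdaptedFrame U e) (hx : x ∈ U) (hD : C.IsTanakaWebster D)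
    (u : TangentSpace (𝓡 5) x) (i : Fin 5) : C.connMatrix D e x u i i = 0 := by
  linarith [he.connMatrix_skew hx hD u i i]

lemma connMatrix_four (he : C.IsAdaptedFrame U e) (hx : x ∈ U) (hD : C.IsTanakaWebster D)
    (u : TangentSpace (𝓡 5) x) (i : Fin 5) : C.connMatrix D e x u i 4 = 0 := by
  have h : e 4 =ᶠ[𝓝 x] C.ξ := by
    filter_upwards [he.isOpen.mem_nhds hx] with y hy
    exact (he.adapted y hy).ξ_four
  rw [he.connMatrix_skew hx hD, connMatrix, cov_congr D (he.diffAt hx 4) h, hD.parallel_ξ]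
  simp

lemma cov_eq_sum (he : C.IsAdaptedFrame U e) (hx : x ∈ U) (u : TangentSpace (𝓡 5) x)
    (i : Fin 5) : D (e i) x u = ∑ j, C.connMatrix D e x u i j • e j x :=
  ((he.adapted x hx).sum_g_smul _).symm

variable [T2Space M]

lemma cov_of_eq_J (he : C.IsAdaptedFrame U e) (hx : x ∈ U) (hD : C.IsTanakaWebster D)
    (hC : C.IsStrictlyPseudoconvexCR) {i j : Fin 5} (h : ∀ y ∈ U, e j y = C.J y (e i y))
    (u : TangentSpace (𝓡 5) x) : D (e j) x u = C.J x (D (e i) x u) := by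
  obtain ⟨E, hE, hEe⟩ := he.exists_isAdaptedNear hx
  rw [← cov_congr D ((hE.smooth i).diffAt x) (hEe i), ← cov_JF hD hC (hE.smooth i)]
  refine cov_congr D (he.diffAt hx j) ?_ u
  filter_upwards [hEe i, he.isOpen.mem_nhds hx] with y hy hyU
  rw [h y hyU, JF, hy]

lemma cov_one (he : C.IsAdaptedFrame U e) (hx : x ∈ U) (hD : C.IsTanakaWebster D)
    (hC : C.IsStrictlyPseudoconvexCR) (u : TangentSpace (𝓡 5) x) :
    D (e 1) x u = C.J x (D (e 0) x u) :=
  he.cov_of_eq_J hx hD hC (fun y hy ↦ (he.adapted y hy).J_zero) u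

lemma connMatrix_one_two (he : C.IsAdaptedFrame U e) (hx : x ∈ U) (hD : C.IsTanakaWebster D)
    (hC : C.IsStrictlyPseudoconvexCR) (u : TangentSpace (𝓡 5) x) :
    C.connMatrix D e x u 1 2 = -C.connMatrix D e x u 0 3 := by
  rw [connMatrix, he.cov_one hx hD hC, C.g_J_left, connMatrix, (he.adapted x hx).J_two]

lemma connMatrix_one_three (he : C.IsAdaptedFrame U e) (hx : x ∈ U) (hD : C.IsTanakaWebster D)
    (hC : C.IsStrictlyPseudoconvexCR) (u : TangentSpace (𝓡 5) x) :
    C.connMatrix D e x u 1 3 = C.connMatrix D e x u 0 2 := by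
  rw [connMatrix, he.cov_one hx hD hC, C.g_J_left, connMatrix, (he.adapted x hx).J_three, map_neg,
    neg_neg]

end IsAdaptedFrame

/-! ### The connection induced on the canonical bundle -/

namespace IsAdaptedBasis

variable {x : M} {e : Fin 5 → TangentSpace (𝓡 5) x}

lemma proj_of_ne (h : C.IsAdaptedBasis x e) {i : Fin 5} (hi : i ≠ 4) : C.proj x (e i) = e i := by
  simp [proj, h.η_eq, hi]

lemma dual01_zero (h : C.IsAdaptedBasis x e) (v : TangentSpace (𝓡 5) x) :
    (C.dual01 x (e 0)).1 v
      = 1 / 2 * ((C.g.inner x (e 0) v : ℂ) - Complex.I * (C.g.inner x (e 1) v : ℂ)) := by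
  rw [h.J_zero]
  simp [dual01, h.proj_of_ne]

lemma dual01_two (h : C.IsAdaptedBasis x e) (v : TangentSpace (𝓡 5) x) :
    (C.dual01 x (e 2)).1 v
      = 1 / 2 * ((C.g.inner x (e 2) v : ℂ) - Complex.I * (C.g.inner x (e 3) v : ℂ)) := by
  rw [h.J_two]
  simp [dual01, h.proj_of_ne]

end IsAdaptedBasis

lemma sqrt_two_mul_sqrt_two : (Real.sqrt 2 : ℂ) * (Real.sqrt 2 : ℂ) = 2 := by
  rw [← Complex.ofReal_mul, Real.mul_self_sqrt (by norm_num)]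
  norm_num

/-- The complex form `g(e_i, ·) - i g(e_j, ·)`; for `(i, j) = (1, 2)` and `(3, 4)`,
counted from one, these are `√2 θ̄₁` and `√2 θ̄₂`. -/
def coframe (C : ContactMetric M) (e : Fin 5 → Π x : M, TangentSpace (𝓡 5) x) (i j : Fin 5) (x : M)
    (v : TangentSpace (𝓡 5) x) : ℂ :=
  (C.g.inner x (e i x) v : ℂ) - Complex.I * (C.g.inner x (e j x) v : ℂ)

lemma unitSection_apply {e : Fin 5 → Π x : M, TangentSpace (𝓡 5) x} {x : M}
    (h : C.IsAdaptedBasis x (fun i ↦ e i x)) (v w : TangentSpace (𝓡 5) x) :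
    (C.unitSection e x).1 v w
      = 1 / 2 * (C.coframe e 0 1 x v * C.coframe e 2 3 x w
          - C.coframe e 0 1 x w * C.coframe e 2 3 x v) := by
  have h0 := h.dual01_zero
  have h2 := h.dual01_two
  simp only [unitSection, wedge, thetaBar, LinearMap.mk₂_apply, Submodule.coe_smul,
    LinearMap.smul_apply, smul_eq_mul, h0, h2, coframe]
  linear_combination (1 / 4 *
    (((C.g.inner x (e 0 x) v : ℂ) - Complex.I * (C.g.inner x (e 1 x) v : ℂ))
            * ((C.g.inner x (e 2 x) w : ℂ) - Complex.I * (C.g.inner x (e 3 x) w : ℂ))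
          - ((C.g.inner x (e 0 x) w : ℂ) - Complex.I * (C.g.inner x (e 1 x) w : ℂ))
            * ((C.g.inner x (e 2 x) v : ℂ) - Complex.I * (C.g.inner x (e 3 x) v : ℂ))))
    * sqrt_two_mul_sqrt_two

/-- `τ(Z̄₁, Z̄₂) = 1` for the unit section `τ`. -/
lemma evalZZ_unitSection {e : Fin 5 → Π x : M, TangentSpace (𝓡 5) x} {x : M}
    (h : C.IsAdaptedBasis x (fun i ↦ e i x)) :
    C.evalZZ x (fun v w ↦ (C.unitSection e x).1 v w) (e 0 x) (e 2 x) = 1 := by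
  have hs : (Real.sqrt 2 : ℂ) ≠ 0 := by
    rw [Complex.ofReal_ne_zero]
    positivity
  have ho := h.orthonormal
  have h0 := h.J_zero
  have h2 := h.J_two
  simp only [evalZZ, evalZ, ← h0, ← h2, unitSection_apply h, coframe, ho]
  rw [div_eq_iff hs, ← mul_div_assoc, ← add_div, div_eq_iff hs, one_mul, sqrt_two_mul_sqrt_two]
  norm_num [Fin.ext_iff]
  linear_combination (-3 / 2 : ℂ) * Complex.I_sq

namespace IsAdaptedFrame

variable {U : Set M} {e : Fin 5 → Π x : M, TangentSpace (𝓡 5) x} {x : M}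

lemma mdifferentiableAt_coframe (he : C.IsAdaptedFrame U e) (hx : x ∈ U) (i j : Fin 5)
    {V : Π x : M, TangentSpace (𝓡 5) x} (hV : DiffFieldAt V x) :
    MDifferentiableAt (𝓡 5) 𝓘(ℝ, ℂ) (fun y ↦ C.coframe e i j y (V y)) x := by
  exact (mdifferentiableAt_ofReal (C.mdifferentiableAt_g (he.diffAt hx i) hV)).sub
    (mdifferentiableAt_const.mul
      (mdifferentiableAt_ofReal (C.mdifferentiableAt_g (he.diffAt hx j) hV)))

lemma dirDeriv_coframe (he : C.IsAdaptedFrame U e) (hx : x ∈ U) (hD : C.IsTanakaWebster D)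
    (i j : Fin 5) (u : TangentSpace (𝓡 5) x) {V : Π x : M, TangentSpace (𝓡 5) x}
    (hV : DiffFieldAt V x) :
    dirDeriv (fun y ↦ C.coframe e i j y (V y)) x u
      = ((C.g.inner x (D (e i) x u) (V x) : ℂ) - Complex.I * (C.g.inner x (D (e j) x u) (V x) : ℂ))
        + C.coframe e i j x (D V x u) := by
  have hi := C.mdifferentiableAt_g (he.diffAt hx i) hV
  have hj := C.mdifferentiableAt_g (he.diffAt hx j) hV
  have hI : MDifferentiableAt (𝓡 5) 𝓘(ℝ, ℂ) (fun _ : M ↦ -Complex.I) x := mdifferentiableAt_const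
  have e1 : (fun y ↦ C.coframe e i j y (V y))
      = fun y ↦ (C.g.inner y (e i y) (V y) : ℂ)
        + (-Complex.I) * (C.g.inner y (e j y) (V y) : ℂ) := by
    funext y
    simp only [coframe]
    ring
  have hm : MDifferentiableAt (𝓡 5) 𝓘(ℝ, ℂ)
      (fun y ↦ (-Complex.I) * (C.g.inner y (e j y) (V y) : ℂ)) x :=
    hI.mul (mdifferentiableAt_ofReal hj)
  have d1 := dirDeriv_clm Complex.ofRealCLM hi u
  have d2 := dirDeriv_clm Complex.ofRealCLM hj u
  simp only [Complex.ofRealCLM_apply] at d1 d2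
  rw [e1, dirDeriv_add (mdifferentiableAt_ofReal hi) hm,
    dirDeriv_mul hI (mdifferentiableAt_ofReal hj), dirDeriv_const, d1, d2,
    hD.parallel_g x u _ _ (he.diffAt hx i) hV, hD.parallel_g x u _ _ (he.diffAt hx j) hV]
  push_cast [coframe]
  ring

variable [T2Space M]

lemma cov_coframe_zero (he : C.IsAdaptedFrame U e) (hx : x ∈ U) (hD : C.IsTanakaWebster D)
    (hC : C.IsStrictlyPseudoconvexCR) (u v : TangentSpace (𝓡 5) x) :
    (C.g.inner x (D (e 0) x u) v : ℂ) - Complex.I * (C.g.inner x (D (e 1) x u) v : ℂ)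
      = Complex.I * C.connMatrix D e x u 0 1 * C.coframe e 0 1 x v
        + (C.connMatrix D e x u 0 2 + Complex.I * C.connMatrix D e x u 0 3)
          * C.coframe e 2 3 x v := by
  rw [he.cov_eq_sum hx u 0, he.cov_eq_sum hx u 1]
  simp only [Fin.sum_univ_five, map_add, map_smul, add_apply, smul_apply, smul_eq_mul,
    he.connMatrix_four hx hD, he.connMatrix_self hx hD, he.connMatrix_one_two hx hD hC,
    he.connMatrix_one_three hx hD hC, he.connMatrix_skew hx hD u 1 0, coframe]
  push_cast
  linear_combination (C.connMatrix D e x u 0 1 * C.g.inner x (e 1 x) v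
    + C.connMatrix D e x u 0 3 * C.g.inner x (e 3 x) v : ℂ) * Complex.I_sq

lemma cov_coframe_two (he : C.IsAdaptedFrame U e) (hx : x ∈ U) (hD : C.IsTanakaWebster D)
    (hC : C.IsStrictlyPseudoconvexCR) (u v : TangentSpace (𝓡 5) x) :
    (C.g.inner x (D (e 2) x u) v : ℂ) - Complex.I * (C.g.inner x (D (e 3) x u) v : ℂ)
      = Complex.I * C.connMatrix D e x u 2 3 * C.coframe e 2 3 x v
        + (-C.connMatrix D e x u 0 2 + Complex.I * C.connMatrix D e x u 0 3)
          * C.coframe e 0 1 x v := by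
  rw [he.cov_eq_sum hx u 2, he.cov_eq_sum hx u 3]
  simp only [Fin.sum_univ_five, map_add, map_smul, add_apply, smul_apply, smul_eq_mul,
    he.connMatrix_four hx hD, he.connMatrix_self hx hD, he.connMatrix_skew hx hD u 2 0,
    he.connMatrix_skew hx hD u 2 1, he.connMatrix_skew hx hD u 3 0,
    he.connMatrix_skew hx hD u 3 1, he.connMatrix_skew hx hD u 3 2,
    he.connMatrix_one_two hx hD hC, he.connMatrix_one_three hx hD hC, coframe]
  push_cast
  linear_combination (C.connMatrix D e x u 2 3 * C.g.inner x (e 3 x) v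
    + C.connMatrix D e x u 0 3 * C.g.inner x (e 1 x) v : ℂ) * Complex.I_sq

/-- The covariant derivative of a local section `f τ` of the canonical bundle. -/
lemma inducedConn_smul_unitSection (he : C.IsAdaptedFrame U e) (hx : x ∈ U)
    (hD : C.IsTanakaWebster D) (hC : C.IsStrictlyPseudoconvexCR) {f : M → ℂ}
    (hf : MDifferentiableAt (𝓡 5) 𝓘(ℝ, ℂ) f x) (u v w : TangentSpace (𝓡 5) x) :
    C.inducedConn D (fun y ↦ f y • C.unitSection e y) x u v w
      = (dirDeriv f x u + f x * (Complex.I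
          * (C.connMatrix D e x u 0 1 + C.connMatrix D e x u 2 3)))
        * (C.unitSection e x).1 v w := by
  have hb := he.adapted x hx
  have hv := diffFieldAt_ext v
  have hw := diffFieldAt_ext w
  have h1 : (fun y ↦ (f y • C.unitSection e y).1 (ext v y) (ext w y))
      =ᶠ[𝓝 x] fun y ↦ f y * ((1 / 2 : ℂ)
        * (C.coframe e 0 1 y (ext v y) * C.coframe e 2 3 y (ext w y)
          + (-1) * (C.coframe e 0 1 y (ext w y) * C.coframe e 2 3 y (ext v y)))) := by
    filter_upwards [he.isOpen.mem_nhds hx] with y hy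
    rw [Submodule.coe_smul, LinearMap.smul_apply, LinearMap.smul_apply, smul_eq_mul,
      unitSection_apply (he.adapted y hy)]
    ring
  have hc : ∀ c : ℂ, MDifferentiableAt (𝓡 5) 𝓘(ℝ, ℂ) (fun _ : M ↦ c) x := fun c ↦
    mdifferentiableAt_const
  have m1 := he.mdifferentiableAt_coframe hx 0 1 hv
  have m2 := he.mdifferentiableAt_coframe hx 2 3 hw
  have m3 := he.mdifferentiableAt_coframe hx 0 1 hw
  have m4 := he.mdifferentiableAt_coframe hx 2 3 hv
  have m34 : MDifferentiableAt (𝓡 5) 𝓘(ℝ, ℂ)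
    (fun y ↦ (-1) * (C.coframe e 0 1 y (ext w y) * C.coframe e 2 3 y (ext v y))) x :=
    (hc _).mul (m3.mul m4)
  have m12 : MDifferentiableAt (𝓡 5) 𝓘(ℝ, ℂ)
    (fun y ↦ C.coframe e 0 1 y (ext v y) * C.coframe e 2 3 y (ext w y)) x := m1.mul m2
  have ms : MDifferentiableAt (𝓡 5) 𝓘(ℝ, ℂ)
    (fun y ↦ C.coframe e 0 1 y (ext v y) * C.coframe e 2 3 y (ext w y)
      + (-1) * (C.coframe e 0 1 y (ext w y) * C.coframe e 2 3 y (ext v y))) x := m12.add m34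
  have mh : MDifferentiableAt (𝓡 5) 𝓘(ℝ, ℂ)
    (fun y ↦ (1 / 2 : ℂ) * (C.coframe e 0 1 y (ext v y) * C.coframe e 2 3 y (ext w y)
      + (-1) * (C.coframe e 0 1 y (ext w y) * C.coframe e 2 3 y (ext v y)))) x := (hc _).mul ms
  have mp : MDifferentiableAt (𝓡 5) 𝓘(ℝ, ℂ)
    (fun y ↦ C.coframe e 0 1 y (ext w y) * C.coframe e 2 3 y (ext v y)) x := m3.mul m4
  rw [inducedConn, dirDeriv_congr h1, dirDeriv_mul hf mh, dirDeriv_mul (hc _) ms,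
    dirDeriv_add m12 m34, dirDeriv_mul m1 m2, dirDeriv_mul (hc _) mp, dirDeriv_mul m3 m4,
    dirDeriv_const, dirDeriv_const,
    he.dirDeriv_coframe hx hD _ _ u hv, he.dirDeriv_coframe hx hD _ _ u hw,
    he.dirDeriv_coframe hx hD _ _ u hv, he.dirDeriv_coframe hx hD _ _ u hw,
    he.cov_coframe_zero hx hD hC, he.cov_coframe_zero hx hD hC, he.cov_coframe_two hx hD hC,
    he.cov_coframe_two hx hD hC]
  simp only [Submodule.coe_smul, LinearMap.smul_apply, smul_eq_mul, unitSection_apply hb, ext_self]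
  ring

/-- The connection form of the induced connection is `i (ω₁₂ + ω₃₄)`. -/
lemma connForm_inducedConn (he : C.IsAdaptedFrame U e) (hx : x ∈ U) (hD : C.IsTanakaWebster D)
    (hC : C.IsStrictlyPseudoconvexCR) (u : TangentSpace (𝓡 5) x) :
    C.connForm (C.inducedConn D) e x u
      = Complex.I * (C.connMatrix D e x u 0 1 + C.connMatrix D e x u 2 3) := by
  have h : C.inducedConn D (C.unitSection e) x u = fun v w ↦ (Complex.I
      * (C.connMatrix D e x u 0 1 + C.connMatrix D e x u 2 3)) * (C.unitSection e x).1 v w := by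
    funext v w
    have h1 := he.inducedConn_smul_unitSection hx hD hC (f := fun _ ↦ 1) mdifferentiableAt_const
      u v w
    simp only [one_smul, dirDeriv_const, zero_add, one_mul] at h1
    exact h1
  have h2 := evalZZ_unitSection (he.adapted x hx)
  rw [connForm, h]
  simp only [evalZZ, evalZ] at h2 ⊢
  linear_combination (Complex.I
      * (C.connMatrix D e x u 0 1 + C.connMatrix D e x u 2 3)) * h2

lemma isUnitaryConn_inducedConn (hD : C.IsTanakaWebster D) (hC : C.IsStrictlyPseudoconvexCR) :
    C.IsUnitaryConn (C.inducedConn D) := by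
  intro U e he x hx u
  rw [he.connForm_inducedConn hx hD hC]
  refine ⟨by simp, fun f hf v w ↦ he.inducedConn_smul_unitSection hx hD hC hf u v w⟩

end IsAdaptedFrame

/-! ### The curvature of the canonical bundle -/

namespace IsAdaptedFrame

variable {U : Set M} {e : Fin 5 → Π x : M, TangentSpace (𝓡 5) x} {x : M}

lemma g_cov_cov (he : C.IsAdaptedFrame U e) (hx : x ∈ U) (u v : TangentSpace (𝓡 5) x)
    (i j : Fin 5) : C.g.inner x (D (e i) x u) (D (e j) x v)
      = ∑ k, C.connMatrix D e x u i k * C.connMatrix D e x v j k := by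
  have ho := (he.adapted x hx).orthonormal
  rw [he.cov_eq_sum hx u i, he.cov_eq_sum hx v j]
  simp [map_sum, sum_apply, ho, mul_comm]

variable [T2Space M]

/-- The quadratic terms of the structure equations for `ω₁₂` and `ω₃₄` cancel each other. -/
lemma g_cov_cov_cancel (he : C.IsAdaptedFrame U e) (hx : x ∈ U) (hD : C.IsTanakaWebster D)
    (hC : C.IsStrictlyPseudoconvexCR) (u v : TangentSpace (𝓡 5) x) :
    C.g.inner x (D (e 0) x v) (D (e 1) x u) + C.g.inner x (D (e 2) x v) (D (e 3) x u)
      = C.g.inner x (D (e 0) x u) (D (e 1) x v) + C.g.inner x (D (e 2) x u) (D (e 3) x v) := by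
  simp only [he.g_cov_cov hx, Fin.sum_univ_five, he.connMatrix_four hx hD,
    he.connMatrix_self hx hD, he.connMatrix_skew hx hD _ 1 0, he.connMatrix_skew hx hD _ 2 0,
    he.connMatrix_skew hx hD _ 2 1, he.connMatrix_skew hx hD _ 3 0,
    he.connMatrix_skew hx hD _ 3 1, he.connMatrix_skew hx hD _ 3 2,
    he.connMatrix_one_two hx hD hC, he.connMatrix_one_three hx hD hC]
  ring

/-- The curvature of the canonical bundle is `i` times the Ricci form. -/
lemma curvForm_inducedConn (he : C.IsAdaptedFrame U e) (hx : x ∈ U) (hD : C.IsTanakaWebster D)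
    (hC : C.IsStrictlyPseudoconvexCR) {E : Fin 5 → Π x : M, TangentSpace (𝓡 5) x}
    (hE : C.IsAdaptedNear x E) (hEe : ∀ i, E i =ᶠ[𝓝 x] e i) {u v : TangentSpace (𝓡 5) x}
    {X Y : Π x : M, TangentSpace (𝓡 5) x} (hX : SmoothField X) (hY : SmoothField Y)
    (hXu : X =ᶠ[𝓝 x] ext u) (hYv : Y =ᶠ[𝓝 x] ext v) :
    C.curvForm (C.inducedConn D) e x u v = Complex.I * (C.ricciForm D E x X Y : ℂ) := by
  have hcov : ∀ i w, D (e i) x w = D (E i) x w := fun i w ↦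
    (cov_congr D ((hE.smooth i).diffAt x) (hEe i) w).symm
  have hEx : ∀ i, e i x = E i x := fun i ↦ ((hEe i).self_of_nhds).symm
  -- the derivative of `A_e(Y) = i (g(∇_Y e₁, e₂) + g(∇_Y e₃, e₄))` along `u`
  have key : ∀ {Y : Π x : M, TangentSpace (𝓡 5) x} {v : TangentSpace (𝓡 5) x}, SmoothField Y →
      Y =ᶠ[𝓝 x] ext v → ∀ u,
      dirDeriv (fun y ↦ C.connForm (C.inducedConn D) e y (ext v y)) x u
        = Complex.I * ((C.g.inner x (D (covF D Y (E 0)) x u) (E 1 x)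
            + C.g.inner x (D (E 0) x (Y x)) (D (E 1) x u)
            + (C.g.inner x (D (covF D Y (E 2)) x u) (E 3 x)
              + C.g.inner x (D (E 2) x (Y x)) (D (E 3) x u)) : ℝ) : ℂ) := by
    intro Y v hY hYv u
    have h0 := (hY.covF hD.smooth (hE.smooth 0)).diffAt x
    have h2 := (hY.covF hD.smooth (hE.smooth 2)).diffAt x
    have h1 := (hE.smooth 1).diffAt x
    have h3 := (hE.smooth 3).diffAt x
    have m01 := C.mdifferentiableAt_g h0 h1
    have m23 := C.mdifferentiableAt_g h2 h3
    have e1 : (fun y ↦ C.connForm (C.inducedConn D) e y (ext v y)) =ᶠ[𝓝 x]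
        fun y ↦ (Complex.I • Complex.ofRealCLM) (C.g.inner y (covF D Y (E 0) y) (E 1 y)
          + C.g.inner y (covF D Y (E 2) y) (E 3 y)) := by
      filter_upwards [he.isOpen.mem_nhds hx, hYv, eventually_eventually_nhds.2 (hEe 0), hEe 1,
        eventually_eventually_nhds.2 (hEe 2), hEe 3] with y hyU hyv hy0 hy1 hy2 hy3
      rw [he.connForm_inducedConn hyU hD hC, connMatrix, connMatrix, covF, covF,
        cov_congr D ((hE.smooth 0).diffAt y) hy0, cov_congr D ((hE.smooth 2).diffAt y) hy2, hy1,
        hy3, hyv]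
      simp
    have hm : MDifferentiableAt (𝓡 5) 𝓘(ℝ, ℝ) (fun y ↦ C.g.inner y (covF D Y (E 0) y) (E 1 y)
        + C.g.inner y (covF D Y (E 2) y) (E 3 y)) x := m01.add m23
    rw [dirDeriv_congr e1, dirDeriv_clm _ hm, dirDeriv_add m01 m23,
      hD.parallel_g x u _ _ h0 h1, hD.parallel_g x u _ _ h2 h3]
    rfl
  have hX0 : X x = u := by rw [hXu.self_of_nhds, ext_self]
  have hY0 : Y x = v := by rw [hYv.self_of_nhds, ext_self]
  have hc := he.g_cov_cov_cancel hx hD hC u v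
  simp only [hcov] at hc
  rw [curvForm, extD, key hY hYv, key hX hXu, ← hXu.mlieBracket_vectorField_eq hYv,
    he.connForm_inducedConn hx hD hC, connMatrix, connMatrix, hcov, hcov, hEx, hEx, ricciForm,
    riem, riem, ← hX0, ← hY0]
  rw [← hX0, ← hY0] at hc
  simp only [map_sub, sub_apply]
  have hc' := congrArg (fun t : ℝ ↦ (t : ℂ)) hc
  push_cast at hc' ⊢
  linear_combination Complex.I * hc'

end IsAdaptedFrame

lemma IsAdaptedNear.ricciForm_eq_sum {x : M} {E : Fin 5 → Π x : M, TangentSpace (𝓡 5) x}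
    (hE : C.IsAdaptedNear x E) (hD : CovariantDerivative.ContMDiffCovariantDerivative D ∞)
    {X Y : Π x : M, TangentSpace (𝓡 5) x} (hX : SmoothField X) (hY : SmoothField Y) :
    C.ricciForm D E x X Y = ∑ i, ∑ j, C.g.inner x (X x) (E i x) * C.g.inner x (Y x) (E j x)
      * C.ricciForm D E x (E i) (E j) := by
  have h : ∀ Z W, SmoothField Z → C.g.inner x (riem D X Y Z x) W
      = ∑ i, ∑ j, C.g.inner x (X x) (E i x) * C.g.inner x (Y x) (E j x)
        * C.g.inner x (riem D (E i) (E j) Z x) W := by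
    intro Z W hZ
    rw [hE.riem_left hD hX hZ, map_sum, sum_apply]
    refine Finset.sum_congr rfl fun i _ ↦ ?_
    rw [hE.riem_middle hD hY hZ, map_smul, smul_apply, map_sum, sum_apply, Finset.smul_sum]
    refine Finset.sum_congr rfl fun j _ ↦ ?_
    rw [map_smul, smul_apply, smul_eq_mul, smul_eq_mul]
    ring
  rw [ricciForm, h _ _ (hE.smooth 0), h _ _ (hE.smooth 2), ← Finset.sum_add_distrib]
  refine Finset.sum_congr rfl fun i _ ↦ ?_
  rw [← Finset.sum_add_distrib]
  refine Finset.sum_congr rfl fun j _ ↦ ?_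
  rw [ricciForm]
  ring

/-! ### Self-dual parts -/

section SelfDual

variable {x : M} {e : Fin 5 → TangentSpace (𝓡 5) x}

lemma vol_eq (h : C.IsAdaptedBasis x e) (u v : TangentSpace (𝓡 5) x) :
    C.vol x e ![e 0, e 1, e 4, u, v]
      = C.g.inner x (e 2) u * C.g.inner x (e 3) v - C.g.inner x (e 3) u * C.g.inner x (e 2) v ∧
    C.vol x e ![e 0, e 2, e 4, u, v]
      = C.g.inner x (e 3) u * C.g.inner x (e 1) v - C.g.inner x (e 1) u * C.g.inner x (e 3) v ∧
    C.vol x e ![e 0, e 3, e 4, u, v]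
      = C.g.inner x (e 1) u * C.g.inner x (e 2) v - C.g.inner x (e 2) u * C.g.inner x (e 1) v ∧
    C.vol x e ![e 1, e 2, e 4, u, v]
      = C.g.inner x (e 0) u * C.g.inner x (e 3) v - C.g.inner x (e 3) u * C.g.inner x (e 0) v ∧
    C.vol x e ![e 1, e 3, e 4, u, v]
      = C.g.inner x (e 2) u * C.g.inner x (e 0) v - C.g.inner x (e 0) u * C.g.inner x (e 2) v ∧
    C.vol x e ![e 2, e 3, e 4, u, v]
      = C.g.inner x (e 0) u * C.g.inner x (e 1) v - C.g.inner x (e 1) u * C.g.inner x (e 0) v := by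
  have ho := h.orthonormal
  have key : ∀ i j : Fin 5, C.vol x e ![e i, e j, e 4, u, v]
      = Matrix.det (Matrix.of fun k l ↦ ![if k = i then 1 else 0, if k = j then 1 else 0,
          if k = 4 then 1 else 0, C.g.inner x (e k) u, C.g.inner x (e k) v] l) := by
    intro i j
    rw [vol]
    congr 1
    ext k l
    fin_cases l <;> simp [ho]
  have hmat : ∀ N : Fin 5 → Fin 5 → ℝ, Matrix.of N
      = !![N 0 0, N 0 1, N 0 2, N 0 3, N 0 4; N 1 0, N 1 1, N 1 2, N 1 3, N 1 4;
          N 2 0, N 2 1, N 2 2, N 2 3, N 2 4; N 3 0, N 3 1, N 3 2, N 3 3, N 3 4;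
          N 4 0, N 4 1, N 4 2, N 4 3, N 4 4] := by
    intro N
    ext k l
    fin_cases k <;> fin_cases l <;> rfl
  have hs : (Fin.succAbove (1 : Fin 5) 2 = 3) ∧
      (Fin.succAbove (1 : Fin 5) 3 = 4) ∧
      (Fin.succAbove (2 : Fin 5) 2 = 3) ∧
      (Fin.succAbove (2 : Fin 5) 3 = 4) ∧
      (Fin.succAbove (3 : Fin 5) 2 = 2) ∧
      (Fin.succAbove (3 : Fin 5) 3 = 4) ∧
      (Fin.succAbove (4 : Fin 5) 2 = 2) ∧
      (Fin.succAbove (4 : Fin 5) 3 = 3) ∧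
      (Fin.succAbove (1 : Fin 4) 2 = 3) ∧
      (Fin.succAbove (2 : Fin 4) 2 = 3) ∧
      (Fin.succAbove (3 : Fin 4) 2 = 2) := by decide
  obtain ⟨s0, s1, s2, s3, s4, s5, s8, s9, s10⟩ := hs
  refine ⟨?_, ?_, ?_, ?_, ?_, ?_⟩ <;>
  · rw [key, hmat]
    simp [Fin.ext_iff]
    simp [Matrix.det_succ_column_zero, Fin.sum_univ_succ, s0, s1, s2, s3, s4, s5, s10]
    try ring

/-- The self-dual part of a two-form whose horizontal part has the coefficients `b_{ij}`, in the
case that the coefficients along `e₁ ∧ e₃ - e₂ ∧ e₄` and `e₁ ∧ e₄ + e₂ ∧ e₃` vanish: it is the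
`dη`-component. -/
lemma selfDualPart_eq (h : C.IsAdaptedBasis x e)
    {β : TangentSpace (𝓡 5) x → TangentSpace (𝓡 5) x → ℂ} {b : Fin 4 → Fin 4 → ℂ}
    (hβ : ∀ u v, β (C.proj x u) (C.proj x v)
      = ∑ i, ∑ j, (C.g.inner x (e i.castSucc) u : ℂ) * (C.g.inner x (e j.castSucc) v : ℂ) * b i j)
    (hb : ∀ i j, b i j = -b j i) (h02 : b 0 2 = b 1 3) (h03 : b 0 3 = -b 1 2)
    (u v : TangentSpace (𝓡 5) x) :
    C.selfDualPart x e β u v = 1 / 2 * (b 0 1 + b 2 3)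
      * ((C.g.inner x (e 0) u * C.g.inner x (e 1) v - C.g.inner x (e 1) u * C.g.inner x (e 0) v)
        + (C.g.inner x (e 2) u * C.g.inner x (e 3) v
          - C.g.inner x (e 3) u * C.g.inner x (e 2) v) : ℝ) := by
  have ho := h.orthonormal
  obtain ⟨v01, v02, v03, v12, v13, v23⟩ := vol_eq h u v
  have hij : ∀ i j : Fin 4, β (C.proj x (e i.castSucc)) (C.proj x (e j.castSucc)) = b i j := by
    intro i j
    have hoC : ∀ i j, (C.g.inner x (e i) (e j) : ℂ) = if i = j then 1 else 0 := by
      intro i j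
      rw [ho]
      split_ifs <;> simp
    rw [hβ]
    simp [hoC]
  have h01' := hij 0 1
  have h02' := hij 0 2
  have h03' := hij 0 3
  have h12' := hij 1 2
  have h13' := hij 1 3
  have h23' := hij 2 3
  simp only [Fin.castSucc_zero, Fin.castSucc_one, Fin.reduceCastSucc]
    at h01' h02' h03' h12' h13' h23'
  have i0 : Finset.Ioi (0 : Fin 5) = {1, 2, 3, 4} := by decide
  have i1 : Finset.Ioi (1 : Fin 5) = {2, 3, 4} := by decide
  have i2 : Finset.Ioi (2 : Fin 5) = {3, 4} := by decide
  have i3 : Finset.Ioi (3 : Fin 5) = {4} := by decide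
  have i4 : Finset.Ioi (4 : Fin 5) = ∅ := by decide
  have hstar : C.star2 x e (fun a b ↦ β (C.proj x a) (C.proj x b)) u v
      = b 0 1 * C.vol x e ![e 0, e 1, e 4, u, v] + b 0 2 * C.vol x e ![e 0, e 2, e 4, u, v]
        + b 0 3 * C.vol x e ![e 0, e 3, e 4, u, v] + b 1 2 * C.vol x e ![e 1, e 2, e 4, u, v]
        + b 1 3 * C.vol x e ![e 1, e 3, e 4, u, v] + b 2 3 * C.vol x e ![e 2, e 3, e 4, u, v] := by
    simp only [star2, hodgeStar, Fin.sum_univ_five, i0, i1, i2, i3, i4, h.η_eq]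
    simp [Finset.sum_insert, Fin.ext_iff, i1, i2, i3, h01', h02', h03', h12', h13', h23']
    ring
  have hd : ∀ i, b i i = 0 := fun i ↦ by linear_combination (1 / 2 : ℂ) * hb i i
  rw [selfDualPart, hstar, hβ, v01, v02, v03, v12, v13, v23]
  simp only [Fin.sum_univ_four, hd, hb 1 0, hb 2 0, hb 2 1, hb 3 0, hb 3 1, hb 3 2, h02, h03,
    Fin.castSucc_zero, Fin.castSucc_one, Fin.reduceCastSucc]
  push_cast
  ring

end SelfDual

/-! ### The spinor field of constant functions -/

lemma contract_zero (x : M) (X : TangentSpace (𝓡 5) x) : C.contract x X 0 = 0 := by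
  ext v
  simp [contract]

lemma wedge_zero (x : M) (α : C.Form01 x) : C.wedge x α 0 = 0 := by
  ext v w
  simp [wedge]

lemma clifford_zero (x : M) (X : TangentSpace (𝓡 5) x) : C.clifford x X 0 = 0 := by
  refine Prod.ext (by simp [clifford]) (Prod.ext (by simp [clifford, contract_zero]) ?_)
  simp only [clifford, Prod.snd_zero, Prod.fst_zero, wedge_zero, smul_zero]
  exact sub_self (0 : C.Form02 x)

lemma clifford_scalar (x : M) {X : TangentSpace (𝓡 5) x} (hX : C.η x X = 0) (c : ℂ) :
    C.clifford x X (c, 0, 0) = (0, ((Real.sqrt 2 : ℂ) * c) • C.dual01 x X, 0) := by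
  refine Prod.ext (by simp [clifford, hX]) (Prod.ext ?_ ?_)
  · simp only [clifford, contract_zero, hX, sub_zero, smul_zero, add_zero, mul_smul]
  · simp only [clifford, wedge_zero, smul_zero]
    exact sub_self (0 : C.Form02 x)

lemma dual01_apply_of_horizontal (x : M) {X : TangentSpace (𝓡 5) x} (hX : C.η x X = 0)
    (v : TangentSpace (𝓡 5) x) :
    (C.dual01 x X).1 v = 1 / 2 * ((C.g.inner x X v : ℂ) - Complex.I * C.g.inner x (C.J x X) v) := by
  simp [dual01, proj, hX]

/-- For horizontal `X` and `Y`, the product `X · Y ·` maps `Λ^{0,0}` to `Λ^{0,0} ⊕ Λ^{0,2}`. -/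
lemma clifford_clifford_scalar (x : M) {X Y : TangentSpace (𝓡 5) x} (hX : C.η x X = 0)
    (hY : C.η x Y = 0) (c : ℂ) :
    C.clifford x X (C.clifford x Y (c, 0, 0))
      = (c * (Complex.I * C.g.inner x (C.J x Y) X - C.g.inner x Y X), 0,
        (2 * c) • C.wedge x (C.dual01 x X) (C.dual01 x Y)) := by
  have hp : C.proj x X = X := by simp [proj, hX]
  rw [clifford_scalar x hY]
  refine Prod.ext ?_ (Prod.ext ?_ ?_)
  · have h1 := (C.dual01 x Y).2 X
    have h2 := C.dual01_apply_of_horizontal x hY X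
    simp only [clifford, hp, Submodule.coe_smul, LinearMap.smul_apply, h1, h2, smul_eq_mul, hX,
      Complex.ofReal_zero]
    linear_combination (-c * (C.g.inner x Y X - Complex.I * C.g.inner x (C.J x Y) X) : ℂ) / 4
      * (1 - Complex.I ^ 2) * sqrt_two_mul_sqrt_two
      + (c * (C.g.inner x Y X - Complex.I * C.g.inner x (C.J x Y) X) : ℂ) / 2 * Complex.I_sq
  · simp [clifford, contract_zero, hX]
  · have h3 : (C.clifford x X (0, ((Real.sqrt 2 : ℂ) * c) • C.dual01 x Y, 0)).2.2
        = (Real.sqrt 2 : ℂ)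
          • C.wedge x (C.dual01 x X) (((Real.sqrt 2 : ℂ) * c) • C.dual01 x Y) := by
      simp only [clifford, smul_zero]
      exact sub_zero (_ : C.Form02 x)
    rw [h3]
    ext v w
    simp only [wedge, Submodule.coe_smul, LinearMap.smul_apply, LinearMap.mk₂_apply, smul_eq_mul]
    linear_combination c * ((C.dual01 x X).1 v * (C.dual01 x Y).1 w
      - (C.dual01 x X).1 w * (C.dual01 x Y).1 v) * sqrt_two_mul_sqrt_two

namespace IsAdaptedBasis

variable {x : M} {e : Fin 5 → TangentSpace (𝓡 5) x}

lemma η_eq_zero (h : C.IsAdaptedBasis x e) {i : Fin 5} (hi : i ≠ 4) : C.η x (e i) = 0 := by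
  rw [h.η_eq, if_neg hi]

lemma dual01_one (h : C.IsAdaptedBasis x e) (v : TangentSpace (𝓡 5) x) :
    (C.dual01 x (e 1)).1 v = Complex.I * (C.dual01 x (e 0)).1 v := by
  rw [h.dual01_zero, C.dual01_apply_of_horizontal x (h.η_eq_zero (by decide)), h.J_one]
  simp only [map_neg, neg_apply, Complex.ofReal_neg]
  linear_combination (1 / 2 * C.g.inner x (e 1) v : ℂ) * Complex.I_sq

lemma dual01_three (h : C.IsAdaptedBasis x e) (v : TangentSpace (𝓡 5) x) :
    (C.dual01 x (e 3)).1 v = Complex.I * (C.dual01 x (e 2)).1 v := by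
  rw [h.dual01_two, C.dual01_apply_of_horizontal x (h.η_eq_zero (by decide)), h.J_three]
  simp only [map_neg, neg_apply, Complex.ofReal_neg]
  linear_combination (1 / 2 * C.g.inner x (e 3) v : ℂ) * Complex.I_sq

/-- If `W` is the connection matrix of a connection that preserves `J`, only the trace part
`W₁₂ + W₃₄` acts on `Λ^{0,0}`: the contributions to `Λ^{0,2}` cancel in pairs. -/
lemma sum_clifford_clifford_scalar (h : C.IsAdaptedBasis x e) {W : Fin 5 → Fin 5 → ℝ}
    (h4 : ∀ i, W i 4 = 0) (h12 : W 1 2 = -W 0 3) (h13 : W 1 3 = W 0 2) (c : ℂ) :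
    ∑ i, ∑ j ∈ Finset.Ioi i, (W i j : ℂ) • C.clifford x (e i) (C.clifford x (e j) (c, 0, 0))
      = (-(Complex.I * (W 0 1 + W 2 3) * c), 0, 0) := by
  have i0 : Finset.Ioi (0 : Fin 5) = {1, 2, 3, 4} := by decide
  have i1 : Finset.Ioi (1 : Fin 5) = {2, 3, 4} := by decide
  have i2 : Finset.Ioi (2 : Fin 5) = {3, 4} := by decide
  have i3 : Finset.Ioi (3 : Fin 5) = {4} := by decide
  have i4 : Finset.Ioi (4 : Fin 5) = ∅ := by decide
  have ho := h.orthonormal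
  have hη : ∀ i : Fin 5, i ≠ 4 → C.η x (e i) = 0 := fun i hi ↦ h.η_eq_zero hi
  have hsum : ∑ i, ∑ j ∈ Finset.Ioi i,
      (W i j : ℂ) • C.clifford x (e i) (C.clifford x (e j) (c, 0, 0))
      = (W 0 1 : ℂ) • C.clifford x (e 0) (C.clifford x (e 1) (c, 0, 0))
        + (W 0 2 : ℂ) • C.clifford x (e 0) (C.clifford x (e 2) (c, 0, 0))
        + (W 0 3 : ℂ) • C.clifford x (e 0) (C.clifford x (e 3) (c, 0, 0))
        + (W 1 2 : ℂ) • C.clifford x (e 1) (C.clifford x (e 2) (c, 0, 0))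
        + (W 1 3 : ℂ) • C.clifford x (e 1) (C.clifford x (e 3) (c, 0, 0))
        + (W 2 3 : ℂ) • C.clifford x (e 2) (C.clifford x (e 3) (c, 0, 0)) := by
    simp only [Fin.sum_univ_five, i0, i1, i2, i3, i4]
    simp [Finset.sum_insert, h4]
    abel
  rw [hsum]
  simp only [C.clifford_clifford_scalar x (hη 0 (by decide)) (hη 1 (by decide)),
    C.clifford_clifford_scalar x (hη 0 (by decide)) (hη 2 (by decide)),
    C.clifford_clifford_scalar x (hη 0 (by decide)) (hη 3 (by decide)),
    C.clifford_clifford_scalar x (hη 1 (by decide)) (hη 2 (by decide)),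
    C.clifford_clifford_scalar x (hη 1 (by decide)) (hη 3 (by decide)),
    C.clifford_clifford_scalar x (hη 2 (by decide)) (hη 3 (by decide)), h12, h13, h.J_one,
    h.J_three, ← h.J_two]
  refine Prod.ext ?_ (Prod.ext ?_ ?_)
  · simp [ho, Fin.ext_iff]
    ring
  · simp
  · ext v w
    simp only [Prod.snd_add, Prod.smul_snd, Submodule.coe_add, Submodule.coe_smul,
      LinearMap.add_apply, LinearMap.smul_apply, smul_eq_mul, wedge, LinearMap.mk₂_apply,
      h.dual01_one, h.dual01_three, Complex.ofReal_neg, Submodule.coe_zero, LinearMap.zero_apply]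
    linear_combination (2 * c * W 0 2 * ((C.dual01 x (e 0)).1 v * (C.dual01 x (e 2)).1 w
      - (C.dual01 x (e 0)).1 w * (C.dual01 x (e 2)).1 v) : ℂ) * Complex.I_sq

end IsAdaptedBasis

namespace IsAdaptedFrame

variable [T2Space M] {U : Set M} {e : Fin 5 → Π x : M, TangentSpace (𝓡 5) x} {x : M}

/-- The constant functions are parallel spinor fields: the connection form `i (ω₁₂ + ω₃₄)` of the
canonical bundle cancels the action of the connection matrix. -/
lemma spinDeriv_smul_ψ₀ (he : C.IsAdaptedFrame U e) (hx : x ∈ U) (hD : C.IsTanakaWebster D)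
    (hC : C.IsStrictlyPseudoconvexCR) (c : ℂ) (u : TangentSpace (𝓡 5) x) :
    C.spinDeriv D (C.inducedConn D) e (fun y ↦ c • C.ψ₀ y) x u = 0 := by
  have hψ : ∀ y : M, c • C.ψ₀ y = (c, 0, 0) := fun y ↦ by simp [ψ₀]
  have hflat : C.flatDeriv e (fun y ↦ c • C.ψ₀ y) x u = 0 := by
    simp [flatDeriv, hψ, evalZ, evalZZ, dirDeriv_const]
  have hsum := (he.adapted x hx).sum_clifford_clifford_scalar (W := C.connMatrix D e x u)
    (he.connMatrix_four hx hD u) (he.connMatrix_one_two hx hD hC u)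
    (he.connMatrix_one_three hx hD hC u) c
  simp only [connMatrix] at hsum
  rw [spinDeriv, hflat, hψ, hsum, he.connForm_inducedConn hx hD hC]
  refine Prod.ext ?_ (by simp)
  simp [connMatrix]
  ring

lemma dirac_smul_ψ₀ (he : C.IsAdaptedFrame U e) (hx : x ∈ U) (hD : C.IsTanakaWebster D)
    (hC : C.IsStrictlyPseudoconvexCR) (c : ℂ) :
    C.dirac D (C.inducedConn D) e (fun y ↦ c • C.ψ₀ y) x = 0 := by
  simp [dirac, kohnDirac, he.spinDeriv_smul_ψ₀ hx hD hC, clifford_zero]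

end IsAdaptedFrame

/-! ### The curvature equation -/

lemma stdForm_skew (i j : Fin 4) : stdForm i j = -stdForm j i := by
  fin_cases i <;> fin_cases j <;> simp [stdForm]

/-- `σ(ψ)` is a multiple of `dη` for a spinor `ψ` of degree zero. -/
lemma sigma_smul_ψ₀ {x : M} (e : Fin 5 → TangentSpace (𝓡 5) x) (c : ℝ) {u v : TangentSpace (𝓡 5) x}
    (hu : C.η x u = 0) (hv : C.η x v = 0) :
    C.sigma x e ((c : ℂ) • C.ψ₀ x) u v = Complex.I * (c ^ 2 * C.g.inner x (C.J x v) u : ℝ) := by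
  have hψ : (c : ℂ) • C.ψ₀ x = ((c : ℂ), 0, 0) := by simp [ψ₀]
  rw [hψ, sigma, C.clifford_clifford_scalar x hu hv, C.g.symm x u v]
  simp [herm, evalZ, evalZZ]
  ring

namespace IsAdaptedBasis

variable {x : M} {e : Fin 5 → TangentSpace (𝓡 5) x}

lemma g_proj (h : C.IsAdaptedBasis x e) (i : Fin 4) (u : TangentSpace (𝓡 5) x) :
    C.g.inner x (C.proj x u) (e i.castSucc) = C.g.inner x (e i.castSucc) u := by
  have hi : i.castSucc ≠ (4 : Fin 5) := (Fin.castSucc_lt_last i).ne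
  rw [C.g.symm, proj, map_sub, map_smul, C.g_ξ_right, h.η_eq, if_neg hi, smul_zero, sub_zero]

end IsAdaptedBasis

lemma g_J_eq_sum {x : M} {e : Fin 5 → TangentSpace (𝓡 5) x} (h : C.IsAdaptedBasis x e)
    (u v : TangentSpace (𝓡 5) x) :
    C.g.inner x (C.J x v) u = ∑ i : Fin 4, ∑ j : Fin 4, C.g.inner x (e i.castSucc) u
      * C.g.inner x (e j.castSucc) v * -stdForm i j := by
  have hJ4 : C.J x (e 4) = 0 := by rw [h.ξ_four, C.J_ξ]
  have hJ := congrArg (C.J x) (h.sum_g_smul v)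
  simp only [Fin.sum_univ_five, map_add, map_smul, hJ4, h.J_one, h.J_three] at hJ
  rw [← h.J_zero, ← h.J_two] at hJ
  rw [← hJ]
  simp only [map_add, map_smul, add_apply, smul_apply, Fin.sum_univ_four, C.g.symm x v]
  simp [stdForm]
  ring

lemma sigma_smul_ψ₀_eq_sum {x : M} {e : Fin 5 → TangentSpace (𝓡 5) x} (h : C.IsAdaptedBasis x e)
    (c : ℝ) (u v : TangentSpace (𝓡 5) x) :
    C.sigma x e ((c : ℂ) • C.ψ₀ x) (C.proj x u) (C.proj x v)
      = ∑ i : Fin 4, ∑ j : Fin 4, (C.g.inner x (e i.castSucc) u : ℂ)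
        * (C.g.inner x (e j.castSucc) v : ℂ) * (-Complex.I * (c ^ 2 * stdForm i j : ℝ)) := by
  rw [sigma_smul_ψ₀ e c (C.η_proj x u) (C.η_proj x v), g_J_eq_sum h]
  simp only [C.g.symm x _ (C.proj x _), h.g_proj]
  push_cast
  simp only [Finset.mul_sum]
  refine Finset.sum_congr rfl fun i _ ↦ Finset.sum_congr rfl fun j _ ↦ ?_
  ring

namespace IsAdaptedFrame

variable [T2Space M] {U : Set M} {e : Fin 5 → Π x : M, TangentSpace (𝓡 5) x} {x : M}

/-- The constant `c` is determined by the trace `-s / 2` of the Ricci form. -/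
lemma selfDualPart_curvForm (he : C.IsAdaptedFrame U e) (hx : x ∈ U) (hD : C.IsTanakaWebster D)
    (hC : C.IsStrictlyPseudoconvexCR) {s : M → ℝ} (hs : C.HasScalarCurvature D s) {c : ℝ}
    (hc : c ^ 2 = -s x) (u v : TangentSpace (𝓡 5) x) :
    C.selfDualPart x (fun i ↦ e i x) (C.curvForm (C.inducedConn D) e x) u v
      = -(1 / 4) * C.selfDualPart x (fun i ↦ e i x)
        (C.sigma x (fun i ↦ e i x) ((c : ℂ) • C.ψ₀ x)) u v := by
  have hb := he.adapted x hx
  obtain ⟨E, hE, hEe⟩ := he.exists_isAdaptedNear hx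
  have hEx : ∀ i, E i x = e i x := fun i ↦ (hEe i).self_of_nhds
  obtain ⟨r1, r2, r3⟩ := hE.ricciForm_relations hD hC hs
  have hF : ∀ u v, C.curvForm (C.inducedConn D) e x (C.proj x u) (C.proj x v)
      = ∑ i : Fin 4, ∑ j : Fin 4, (C.g.inner x (e i.castSucc x) u : ℂ)
        * (C.g.inner x (e j.castSucc x) v : ℂ)
        * (Complex.I * (C.ricciForm D E x (E i.castSucc) (E j.castSucc) : ℂ)) := by
    intro u v
    obtain ⟨X, hX, hXu⟩ := exists_smoothField_ext (C.proj x u)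
    obtain ⟨Y, hY, hYv⟩ := exists_smoothField_ext (C.proj x v)
    have hX0 : X x = C.proj x u := by rw [hXu.self_of_nhds, ext_self]
    have hY0 : Y x = C.proj x v := by rw [hYv.self_of_nhds, ext_self]
    have h4 : ∀ w : TangentSpace (𝓡 5) x, C.g.inner x (C.proj x w) (e (Fin.last 4) x) = 0 := by
      intro w
      have h : e (Fin.last 4) x = C.ξ x := hb.ξ_four
      rw [h, C.g_ξ_right, C.η_proj]
    rw [he.curvForm_inducedConn hx hD hC hE hEe hX hY hXu hYv,
      hE.ricciForm_eq_sum hD.smooth hX hY]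
    simp only [hX0, hY0, hEx]
    simp only [Fin.sum_univ_castSucc (n := 4), h4, hb.g_proj]
    simp only [zero_mul, mul_zero, add_zero, Finset.sum_const_zero]
    push_cast
    simp only [Finset.mul_sum]
    refine Finset.sum_congr rfl fun i _ ↦ Finset.sum_congr rfl fun j _ ↦ ?_
    ring
  rw [selfDualPart_eq hb hF (fun i j ↦ by rw [ricciForm_swap]; push_cast; ring)
      (congrArg (fun t : ℝ ↦ Complex.I * (t : ℂ)) r2)
      ((congrArg (fun t : ℝ ↦ Complex.I * (t : ℂ)) r3).trans (by push_cast; exact mul_neg _ _)),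
    selfDualPart_eq hb (sigma_smul_ψ₀_eq_sum hb c)
      (fun i j ↦ by rw [stdForm_skew]; push_cast; ring) (by simp [stdForm]) (by simp [stdForm])]
  have h1 : stdForm 0 1 = 1 := by simp [stdForm]
  have h2 : stdForm 2 3 = 1 := by simp [stdForm]
  have r1' := congrArg (fun t : ℝ ↦ (t : ℂ)) r1
  have hc' := congrArg (fun t : ℝ ↦ (t : ℂ)) hc
  rw [h1, h2, mul_one]
  simp only [Fin.castSucc_zero, Fin.castSucc_one, Fin.reduceCastSucc]
  rw [← mul_assoc]
  refine congrArg₂ (· * ·) ?_ rfl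
  push_cast at r1' hc' ⊢
  linear_combination Complex.I / 2 * r1' - Complex.I / 4 * hc'

end IsAdaptedFrame

end ContactMetric

end

end ContactSW

theorem mainTheorem1 {M : Type*} [TopologicalSpace M] [T2Space M]
    [ChartedSpace (EuclideanSpace ℝ (Fin 5)) M] [IsManifold (𝓡 5) ∞ M]
    (C : ContactSW.ContactMetric M) (hC : C.IsStrictlyPseudoconvexCR)
    (D : CovariantDerivative (𝓡 5) (EuclideanSpace ℝ (Fin 5)) (fun x : M ↦ TangentSpace (𝓡 5) x))
    (hD : C.IsTanakaWebster D)
    (s : ℝ) (hs : s < 0) (hscal : C.HasScalarCurvature D (fun _ ↦ s)) :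
    C.IsSeibergWittenSolution D (C.inducedConn D)
      (fun x ↦ (Real.sqrt (-s) : ℂ) • C.ψ₀ x) where
  unitary := ContactSW.ContactMetric.IsAdaptedFrame.isUnitaryConn_inducedConn hD hC
  dirac_eq _ _ he _ hx := he.dirac_smul_ψ₀ hx hD hC _
  curvature_eq _ _ he _ hx u v :=
    he.selfDualPart_curvForm hx hD hC hscal (Real.sq_sqrt (by linarith)) u v
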